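/- Let $\Pi=\{z\in\mathbb C:\operatorname{Im}z>0\}$, let $\mathcal O(\Pi)$ and $\mathcal O(\Pi\times\Pi)$ be the spaces of holomorphic functions on $\Pi$ and $\Pi\times\Pi$, let $\mathbb N=\{0,1,2,\dots\}$ and $(x)_k=x(x+1)\cdots(x+k-1)$. For $\lambda',\lambda''\in\mathbb C$ put $$P_{\lambda',\lambda''}=(\zeta_1-\zeta_2)^2\frac{\partial^2}{\partial\zeta_1\partial\zeta_2}-\lambda''(\zeta_1-\zeta_2)\frac{\partial}{\partial\zeta_1}+\lambda'(\zeta_1-\zeta_2)\frac{\partial}{\partial\zeta_2},$$ and, for $\mu\in\mathbb C$, $\mathrm{Sol}_\mu=\{f\in\mathcal O(\Pi\times\Pi): P_{\lambda',\lambda''}f=\mu f\}$. For $\ell\in\mathbb N$ put $\mu_\ell=-\ell(\lambda'+\lambda''+\ell-1)$ and define the Rankin--Cohen operator, for $f\in\mathcal O(\Pi\times\Pi)$, by $$\big(\mathcal{RC}_{\lambda',\lambda''}^{\lambda'+\lambda''+2\ell}f\big)(\zeta)=\sum_{j=0}^{\ell}(-1)^j\frac{(\lambda'+\ell-j)_j(\lambda''+j)_{\ell-j}}{j!\,(\ell-j)!}\,\frac{\partial^\ell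 f}{\partial\zeta_1^{\ell-j}\partial\zeta_2^{j}}(\zeta,\zeta).$$ If $\operatorname{Re}\lambda',\operatorname{Re}\lambda''>0$, define, for $g\in\mathcal O(\Pi)$, $$\big(\Psi_{\lambda',\lambda''}^{\lambda'+\lambda''+2\ell}g\big)(\zeta_1,\zeta_2)=\frac{(\zeta_1-\zeta_2)^\ell}{2^{\lambda'+\lambda''+2\ell-1}\ell!}\int_{-1}^1 g\Big(\frac{(\zeta_2-\zeta_1)v+(\zeta_1+\zeta_2)}2\Big)(1-v)^{\lambda'+\ell-1}(1+v)^{\lambda''+\ell-1}\,dv,$$ $$c_\ell=\frac{\Gamma(\lambda'+\ell)\Gamma(\lambda''+\ell)}{(\lambda'+\lambda''+2\ell-1)\,\Gamma(\lambda'+\lambda''+\ell-1)\,\ell!},$$ where for $\ell=0$ the product $(\lambda'+\lambda''-1)\Gamma(\lambda'+\lambda''-1)$ is read as $\Gamma(\lambda'+\lambda'')$. Theorem. Let $\lambda',\lambda''\in\mathbb C$. (0) $P_{\lambda',\lambda''}$ is the diagonal Casimir operator up to an affine change: on $\mathcal O(\Pi\times\Pi)$, $$\tfrac18\big(H^2+2XY+2YX\big)=-\tfrac12P_{\lambda',\lambda''}+\tfrac18(\lambda'+\lambda'')(\lambda'+\lambda''-2),$$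 where $H=-\lambda'-\lambda''-2(\zeta_1\partial_{\zeta_1}+\zeta_2\partial_{\zeta_2})$, $X=-\partial_{\zeta_1}-\partial_{\zeta_2}$, $Y=\lambda'\zeta_1+\lambda''\zeta_2+\zeta_1^2\partial_{\zeta_1}+\zeta_2^2\partial_{\zeta_2}$ give the diagonal action of the standard basis of $\mathfrak{sl}(2)$. (1) $\mathrm{Sol}_\mu\neq\{0\}$ if and only if $\mu=\mu_\ell$ for some $\ell\in\mathbb N$. (2) For every $\ell\in\mathbb N$, the function $(\zeta_1-\zeta_2)^\ell(\zeta_1+i)^{-\lambda'-\ell}(\zeta_2+i)^{-\lambda''-\ell}$ (principal branches) belongs to $\mathrm{Sol}_{\mu_\ell}$. (3) Suppose $\operatorname{Re}\lambda',\operatorname{Re}\lambda''>0$ and $\ell\in\mathbb N$. Then $\Psi_{\lambda',\lambda''}^{\lambda'+\lambda''+2\ell}$ is a bijection from $\mathcal O(\Pi)$ onto $\mathrm{Sol}_{\mu_\ell}$. Moreover, $\mathcal{RC}_{\lambda',\lambda''}^{\lambda'+\lambda''+2\ell}\circ\Psi_{\lambda',\lambda''}^{\lambda'+\lambda''+2\ell}=c_\ell\,\mathrm{id}$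 on $\mathcal O(\Pi)$, $c_\ell\neq0$, and the inverse of the bijection is the restriction of $c_\ell^{-1}\,\mathcal{RC}_{\lambda',\lambda''}^{\lambda'+\lambda''+2\ell}$ to $\mathrm{Sol}_{\mu_\ell}$. -/

import Mathlib

/-! Functions on the upper half-plane `ℍ` are honest functions `ℍ → ℂ`, and functions on its square
are `ℍ × ℍ → ℂ`. Complex derivatives are taken after precomposing with
`UpperHalfPlane.ofComplex : ℂ → ℍ`, which is the identity on the open upper half-plane; since the
half-plane is open, values elsewhere never matter. -/

noncomputable section

namespace RankinCohen

open UpperHalfPlane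

/-- Holomorphic functions on the upper half-plane. -/
def HolUHP : Set (ℍ → ℂ) :=
  {g | DifferentiableOn ℂ (fun z : ℂ => g (ofComplex z)) {z : ℂ | 0 < z.im}}

/-- Holomorphic functions (of two complex variables) on the square of the upper half-plane. -/
def HolUHP2 : Set (ℍ × ℍ → ℂ) :=
  {f | DifferentiableOn ℂ (fun p : ℂ × ℂ => f (ofComplex p.1, ofComplex p.2))
    {p : ℂ × ℂ | 0 < p.1.im ∧ 0 < p.2.im}}

/-- The complex derivative of a function on the upper half-plane. -/
def diff (g : ℍ → ℂ) (z : ℍ) : ℂ := deriv (fun w : ℂ => g (ofComplex w)) (z : ℂ)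

/-- The partial derivative `∂/∂ζ₁`. -/
def partial1 (f : ℍ × ℍ → ℂ) (p : ℍ × ℍ) : ℂ := diff (fun z => f (z, p.2)) p.1

/-- The partial derivative `∂/∂ζ₂`. -/
def partial2 (f : ℍ × ℍ → ℂ) (p : ℍ × ℍ) : ℂ := diff (fun z => f (p.1, z)) p.2

/-- The operator
`P = (ζ₁ - ζ₂)² ∂₁∂₂ - λ'' (ζ₁ - ζ₂) ∂₁ + λ' (ζ₁ - ζ₂) ∂₂`. -/
def opP (l₁ l₂ : ℂ) (f : ℍ × ℍ → ℂ) (p : ℍ × ℍ) : ℂ :=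
  ((p.1 : ℂ) - p.2) ^ 2 * partial1 (partial2 f) p
    - l₂ * ((p.1 : ℂ) - p.2) * partial1 f p
    + l₁ * ((p.1 : ℂ) - p.2) * partial2 f p

/-- The space of holomorphic solutions on the square of the half-plane of `P f = μ f`. -/
def Sol (l₁ l₂ μ : ℂ) : Set (ℍ × ℍ → ℂ) :=
  {f | f ∈ HolUHP2 ∧ ∀ p, opP l₁ l₂ f p = μ * f p}

/-! The infinitesimal action `dπ_λ` of `sl(2)` obtained by differentiating
`(π_λ(g) f)(z) = (c z + d)^(-λ) f((a z + b) / (c z + d))`, `g⁻¹ = (a, b; c, d)`, on the standard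
basis `H = (1, 0; 0, -1)`, `X = (0, 1; 0, 0)`, `Y = (0, 0; 1, 0)`. -/

def dpiH (l : ℂ) (g : ℍ → ℂ) (z : ℍ) : ℂ := -l * g z - 2 * (z : ℂ) * diff g z

def dpiX (g : ℍ → ℂ) (z : ℍ) : ℂ := -diff g z

def dpiY (l : ℂ) (g : ℍ → ℂ) (z : ℍ) : ℂ := l * (z : ℂ) * g z + (z : ℂ) ^ 2 * diff g z

/-- `A₁ ⊗ 1 + 1 ⊗ A₂`: the operator `A₁` in the first variable plus `A₂` in the second. -/
def diagAct (A₁ A₂ : (ℍ → ℂ) → ℍ → ℂ) (f : ℍ × ℍ → ℂ) (p : ℍ × ℍ) : ℂ :=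
  A₁ (fun z => f (z, p.2)) p.1 + A₂ (fun z => f (p.1, z)) p.2

/-- The Casimir element `C = (H² + 2XY + 2YX) / 8` acting by the diagonal action
through `dπ_λ' ⊗ dπ_λ''`. -/
def diagCasimir (l₁ l₂ : ℂ) (f : ℍ × ℍ → ℂ) (p : ℍ × ℍ) : ℂ :=
  let tH := diagAct (dpiH l₁) (dpiH l₂)
  let tX := diagAct dpiX dpiX
  let tY := diagAct (dpiY l₁) (dpiY l₂)
  (1 / 8) * (tH (tH f) p + 2 * tX (tY f) p + 2 * tY (tX f) p)

/-- The Pochhammer symbol `(x)_k = x (x + 1) ⋯ (x + k - 1)`. -/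
def poch (x : ℂ) (k : ℕ) : ℂ := (ascPochhammer ℂ k).eval x

/-- The Rankin-Cohen bidifferential operator with parameters `λ'`, `λ''` and
`λ''' = λ' + λ'' + 2ℓ`: a differential operator followed by restriction to the diagonal. -/
def RC (l₁ l₂ : ℂ) (ℓ : ℕ) (f : ℍ × ℍ → ℂ) (z : ℍ) : ℂ :=
  ∑ j ∈ Finset.range (ℓ + 1),
    (-1 : ℂ) ^ j * (poch (l₁ + (ℓ : ℂ) - (j : ℂ)) j * poch (l₂ + (j : ℂ)) (ℓ - j))
      / ((j.factorial : ℂ) * ((ℓ - j).factorial : ℂ))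
      * (partial1^[ℓ - j] (partial2^[j] f)) (z, z)

/-- The holographic operator `Ψ` with parameters `λ'`, `λ''` and `λ''' = λ' + λ'' + 2ℓ`. -/
def Psi (l₁ l₂ : ℂ) (ℓ : ℕ) (g : ℍ → ℂ) (p : ℍ × ℍ) : ℂ :=
  ((p.1 : ℂ) - p.2) ^ ℓ / ((2 : ℂ) ^ (l₁ + l₂ + 2 * (ℓ : ℂ) - 1) * (ℓ.factorial : ℂ)) *
    ∫ v in (-1 : ℝ)..1,
      g (ofComplex ((((p.2 : ℂ) - p.1) * (v : ℂ) + ((p.1 : ℂ) + p.2)) / 2)) *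
        ((1 - v : ℝ) : ℂ) ^ (l₁ + (ℓ : ℂ) - 1) * ((1 + v : ℝ) : ℂ) ^ (l₂ + (ℓ : ℂ) - 1)

/-- The constant
`c_ℓ = Γ(λ'+ℓ) Γ(λ''+ℓ) / ((λ'+λ''+2ℓ-1) Γ(λ'+λ''+ℓ-1) ℓ!)`.
For `ℓ = 0` the product `(λ'+λ''-1) Γ(λ'+λ''-1)` is written `Γ(λ'+λ'')`, which is its
value, also at the removable singularity `λ'+λ'' = 1`. -/
def cConst (l₁ l₂ : ℂ) (ℓ : ℕ) : ℂ :=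
  if ℓ = 0 then Complex.Gamma l₁ * Complex.Gamma l₂ / Complex.Gamma (l₁ + l₂)
  else Complex.Gamma (l₁ + (ℓ : ℂ)) * Complex.Gamma (l₂ + (ℓ : ℂ)) /
    ((l₁ + l₂ + 2 * (ℓ : ℂ) - 1) * Complex.Gamma (l₁ + l₂ + (ℓ : ℂ) - 1) * (ℓ.factorial : ℂ))

/-- The eigenvalue `-ℓ (λ' + λ'' + ℓ - 1)`. -/
def eigenval (l₁ l₂ : ℂ) (ℓ : ℕ) : ℂ := -((ℓ : ℂ) * (l₁ + l₂ + (ℓ : ℂ) - 1))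

/-- The function `(ζ₁ - ζ₂)^ℓ (ζ₁ + i)^(-λ'-ℓ) (ζ₂ + i)^(-λ''-ℓ)`, with principal powers
(`ζ + i` lies in the upper half-plane). -/
def minKType (l₁ l₂ : ℂ) (ℓ : ℕ) (p : ℍ × ℍ) : ℂ :=
  ((p.1 : ℂ) - p.2) ^ ℓ * ((p.1 : ℂ) + Complex.I) ^ (-l₁ - (ℓ : ℂ)) *
    ((p.2 : ℂ) + Complex.I) ^ (-l₂ - (ℓ : ℂ))

end RankinCohen

end

/-! Conjugation by a power of `ζ₁ - ζ₂` shifts the parameters: `P_{λ',λ''}` applied to `(ζ₁ - ζ₂)^ℓ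
h` is `(ζ₁ - ζ₂)^ℓ (μ_ℓ + P_{λ'+ℓ,λ''+ℓ}) h` (`opP_sub_pow_mul`). Hence every `h` in the kernel of
the shifted operator gives an element of `Sol_{μ_ℓ}`. Two kinds of `h` are used: a product of
powers, and averages of `g` over segments against a beta density, for which the equation is the
integral of a total derivative (`opP_avg`).

Conversely, a nonzero solution vanishes along the diagonal to some finite order `k`, and the leading
term of the equation there forces `μ = μ_k` (`mul_partial1_iterate_diag`,
`exists_eigenval_of_ne_zero`). This gives (1).

On functions vanishing to order `ℓ` on the diagonal, the Rankin-Cohen operator is a Pochhammer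
constant times the leading coefficient, by Chu-Vandermonde (`RC_eq_of_vanishing`). For positive real
parts that constant is nonzero and the `μ_k` are distinct, so `RC` is injective on `Sol_{μ_ℓ}`. With
`RC ∘ Psi = c_ℓ`, this yields the bijection and its inverse. -/

noncomputable section

namespace RankinCohen

/-! ### Analyticity of holomorphic functions of two variables. -/

section Osgood

open UpperHalfPlane Metric Complex Filter Topology

/-- Integration along a circle, as a continuous functional on continuous functions on it. -/
def circleFunctional (a : ℂ) (r : NNReal) : C(sphere a (r : ℝ), ℂ) →L[ℂ] ℂ :=
  LinearMap.mkContinuous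
    { toFun := fun φ => ∫ θ in (0 : ℝ)..2 * Real.pi,
        deriv (circleMap a r) θ • φ ⟨circleMap a r θ, circleMap_mem_sphere a r.2 θ⟩
      map_add' := by
        intro φ ψ
        rw [← intervalIntegral.integral_add]
        · simp [mul_add]
        all_goals
          apply Continuous.intervalIntegrable
          simp only [deriv_circleMap]
          fun_prop
      map_smul' := by
        intro c φ
        rw [RingHom.id_apply, ← intervalIntegral.integral_smul]
        congr 1
        ext θ
        simp only [ContinuousMap.smul_apply, smul_eq_mul]
        ring }
    (r * |2 * Real.pi - 0|) (by
      intro φ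
      have := intervalIntegral.norm_integral_le_of_norm_le_const (a := 0) (b := 2 * Real.pi)
        (C := r * ‖φ‖)
        (f := fun θ => deriv (circleMap a r) θ •
          φ ⟨circleMap a r θ, circleMap_mem_sphere a r.2 θ⟩) (by
          intro θ _
          rw [norm_smul]
          gcongr
          · simp [deriv_circleMap]
          · exact φ.norm_coe_le_norm _)
      refine this.trans (le_of_eq ?_)
      ring)

theorem circleFunctional_apply (a : ℂ) (r : NNReal) (φ : C(sphere a (r : ℝ), ℂ)) (g : ℂ → ℂ)
    (h : ∀ k : sphere a (r : ℝ), φ k = g k) :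
    circleFunctional a r φ = ∮ z in C(a, r), g z := by
  simp [circleFunctional, circleIntegral, h]

/-- The slices of a function near a bidisc, as continuous functions on the boundary circle. -/
def slice (a b : ℂ) (r : NNReal) (f : ℂ × ℂ → ℂ)
    (hf : ContinuousOn f (closedBall a (r : ℝ) ×ˢ closedBall b (r : ℝ))) (w : ℂ) :
    C(sphere a (r : ℝ), ℂ) :=
  open Classical in
  if hw : w ∈ closedBall b (r : ℝ) then
    ⟨fun k => f (k, w), by
      refine hf.comp_continuous (by fun_prop) fun k => ⟨sphere_subset_closedBall k.2, hw⟩⟩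
  else 0

theorem slice_apply {a b : ℂ} {r : NNReal} {f : ℂ × ℂ → ℂ}
    (hf : ContinuousOn f (closedBall a (r : ℝ) ×ˢ closedBall b (r : ℝ))) {w : ℂ}
    (hw : w ∈ closedBall b (r : ℝ)) (k : sphere a (r : ℝ)) :
    slice a b r f hf w k = f (k, w) := by
  rw [slice, dif_pos hw]
  rfl

/-- Currying a jointly continuous function gives a map continuous for the sup norm. -/
theorem continuousOn_slice {a b : ℂ} {r : NNReal} {f : ℂ × ℂ → ℂ}
    (hf : ContinuousOn f (closedBall a (r : ℝ) ×ˢ closedBall b (r : ℝ))) :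
    ContinuousOn (slice a b r f hf) (closedBall b (r : ℝ)) := by
  rw [continuousOn_iff_continuous_domRestrict]
  let G : C(closedBall b (r : ℝ) × sphere a (r : ℝ), ℂ) :=
    ⟨fun q => f (q.2, q.1), hf.comp_continuous (by fun_prop)
      fun q => ⟨sphere_subset_closedBall q.2.2, q.1.2⟩⟩
  convert! G.curry.continuous using 1
  ext w k
  rw [Set.domRestrict_apply, slice_apply hf w.2]
  rfl

/-- The Banach-valued Cauchy integral of the slices is analytic. Evaluation at a point of the circle
commutes with the integral, so the scalar Cauchy formula in the second variable identifies it with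
the slice. -/
theorem analyticAt_slice {a b : ℂ} {r : NNReal} (hr : 0 < r) {f : ℂ × ℂ → ℂ}
    (hf : ContinuousOn f (closedBall a (r : ℝ) ×ˢ closedBall b (r : ℝ)))
    (hd : ∀ z ∈ closedBall a (r : ℝ),
      DifferentiableOn ℂ (fun w => f (z, w)) (closedBall b (r : ℝ))) :
    AnalyticAt ℂ (slice a b r f hf) b := by
  have hc := continuousOn_slice hf
  have hci : CircleIntegrable (slice a b r f hf) b r :=
    (hc.mono sphere_subset_closedBall).circleIntegrable r.2
  have := (hasFPowerSeriesOn_cauchy_integral hci hr).analyticAt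
  refine this.congr ?_
  filter_upwards [ball_mem_nhds b (NNReal.coe_pos.2 hr)] with w hw
  ext k
  have hwc := ball_subset_closedBall hw
  have hint : CircleIntegrable (fun z => (z - w)⁻¹ • slice a b r f hf z) b r := by
    refine ContinuousOn.circleIntegrable r.2 ?_
    refine ContinuousOn.smul (ContinuousOn.inv₀ (f := fun z => z - w) (by fun_prop) ?_)
      (hc.mono sphere_subset_closedBall)
    intro z hz h
    rw [sub_eq_zero] at h
    subst h
    exact (ne_of_lt (mem_ball.1 hw)) (mem_sphere.1 hz)
  have hev := (ContinuousMap.evalCLM ℂ k).intervalIntegral_comp_comm hint.out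
  have hcauchy := Complex.two_pi_I_inv_smul_circleIntegral_sub_inv_smul_of_differentiable_on_off_countable
    (f := fun w => f (k, w)) (s := ∅) Set.countable_empty hw
    (hd k (sphere_subset_closedBall k.2)).continuousOn (by
      intro z hz
      exact (hd k (sphere_subset_closedBall k.2)).differentiableAt
        (mem_of_superset (isOpen_ball.mem_nhds hz.1) ball_subset_closedBall))
  rw [slice_apply hf hwc, ← hcauchy]
  simp only [ContinuousMap.smul_apply]
  congr 1
  simp only [circleIntegral]
  refine Eq.trans hev.symm ?_
  refine intervalIntegral.integral_congr fun θ _ => ?_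
  have hθ := slice_apply hf (sphere_subset_closedBall (circleMap_mem_sphere b r.2 θ)) k
  simp only [NNReal.val_eq_coe] at hθ
  simp only [ContinuousMap.evalCLM_apply, ContinuousMap.smul_apply, hθ]

/-- By Cauchy's formula in the first variable, `f (z, w)` is a continuous linear functional of the
product, in the Banach algebra of continuous functions on the circle, of the inverse of `k ↦ k - z`
and the slice at `w`. The first factor is analytic in `z` because inversion is analytic on units,
the second is analytic in `w`. -/
theorem analyticAt_of_bidisc {a b : ℂ} {r : NNReal} (hr : 0 < r) {f : ℂ × ℂ → ℂ}
    (hf : ContinuousOn f (closedBall a (r : ℝ) ×ˢ closedBall b (r : ℝ)))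
    (hd₁ : ∀ w ∈ closedBall b (r : ℝ),
      DifferentiableOn ℂ (fun z => f (z, w)) (closedBall a (r : ℝ)))
    (hd₂ : ∀ z ∈ closedBall a (r : ℝ),
      DifferentiableOn ℂ (fun w => f (z, w)) (closedBall b (r : ℝ))) :
    AnalyticAt ℂ f (a, b) := by
  let ι : C(sphere a (r : ℝ), ℂ) := ⟨fun k => k, continuous_subtype_val⟩
  let K : ℂ → C(sphere a (r : ℝ), ℂ) := fun z => ι - algebraMap ℂ _ z
  have hK : ∀ z ∈ ball a (r : ℝ), IsUnit (K z) := by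
    intro z hz
    rw [ContinuousMap.isUnit_iff_forall_ne_zero]
    intro k h
    have h' : (k : ℂ) = z := by simpa [K, ι, sub_eq_zero] using h
    exact (ne_of_lt (mem_ball.1 hz)) (h' ▸ mem_sphere.1 k.2)
  have ha : a ∈ ball a (r : ℝ) := mem_ball_self (NNReal.coe_pos.2 hr)
  have hKan : AnalyticAt ℂ K a :=
    analyticAt_const.sub ((Algebra.linearMap ℂ C(sphere a (r : ℝ), ℂ)).toContinuousLinearMap.analyticAt a)
  have hinv : AnalyticAt ℂ (fun z => Ring.inverse (K z)) a :=
    AnalyticAt.comp (g := Ring.inverse) (analyticOnNhd_inverse (𝕜 := ℂ) _ (hK a ha)) hKan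
  have h1 : AnalyticAt ℂ (fun p : ℂ × ℂ => Ring.inverse (K p.1)) (a, b) :=
    AnalyticAt.comp (f := Prod.fst) (x := ((a, b) : ℂ × ℂ)) hinv analyticAt_fst
  have h2 : AnalyticAt ℂ (fun p : ℂ × ℂ => slice a b r f hf p.2) (a, b) :=
    AnalyticAt.comp (f := Prod.snd) (x := ((a, b) : ℂ × ℂ)) (analyticAt_slice hr hf hd₂)
      analyticAt_snd
  have h3 := ((circleFunctional a r).analyticAt _).comp (h1.mul h2)
  have h4 := (analyticAt_const (v := (2 * Real.pi * Complex.I : ℂ)⁻¹)).mul h3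
  refine h4.congr ?_
  filter_upwards [prod_mem_nhds (ball_mem_nhds a (NNReal.coe_pos.2 hr))
    (ball_mem_nhds b (NNReal.coe_pos.2 hr))] with p hp
  have hwc := ball_subset_closedBall hp.2
  have hcauchy := Complex.two_pi_I_inv_smul_circleIntegral_sub_inv_smul_of_differentiable_on_off_countable
    (f := fun z => f (z, p.2)) (s := ∅) Set.countable_empty hp.1
    (hd₁ p.2 hwc).continuousOn (by
      intro z hz
      exact (hd₁ p.2 hwc).differentiableAt
        (mem_of_superset (isOpen_ball.mem_nhds hz.1) ball_subset_closedBall))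
  rw [smul_eq_mul] at hcauchy
  refine Eq.trans ?_ hcauchy
  change _ * circleFunctional a r (Ring.inverse (K p.1) * slice a b r f hf p.2) = _
  congr 1
  apply circleFunctional_apply
  intro k
  have hu := Ring.mul_inverse_cancel _ (hK p.1 hp.1)
  have hk := DFunLike.congr_fun hu k
  have : (Ring.inverse (K p.1)) k = ((k : ℂ) - p.1)⁻¹ := by
    refine eq_inv_of_mul_eq_one_right ?_
    simpa [K, ι] using hk
  rw [ContinuousMap.mul_apply, this, slice_apply hf hwc, smul_eq_mul]

/-- Holomorphic functions of two complex variables are analytic. -/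
theorem analyticOnNhd_of_differentiableOn {f : ℂ × ℂ → ℂ} {U : Set (ℂ × ℂ)} (hU : IsOpen U)
    (hf : DifferentiableOn ℂ f U) : AnalyticOnNhd ℂ f U := by
  rintro ⟨a, b⟩ hp
  obtain ⟨ε, hε, hsub⟩ := Metric.nhds_basis_closedBall.mem_iff.1 (hU.mem_nhds hp)
  lift ε to NNReal using hε.le
  rw [← closedBall_prod_same] at hsub
  refine analyticAt_of_bidisc (NNReal.coe_pos.1 hε) (hf.continuousOn.mono hsub) ?_ ?_
  · intro w hw z hz
    have := (hf.differentiableAt (hU.mem_nhds (hsub (Set.mk_mem_prod hz hw))))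
    exact (this.comp z (f := fun z => (z, w)) (by fun_prop)).differentiableWithinAt
  · intro z hz w hw
    have := (hf.differentiableAt (hU.mem_nhds (hsub (Set.mk_mem_prod hz hw))))
    exact (this.comp w (f := fun w => (z, w)) (by fun_prop)).differentiableWithinAt

end Osgood

/-! ### Partial derivatives on the square of the half-plane and identities for `P`. -/

section Calculus

open UpperHalfPlane Metric Filter Topology

/-- Extension of a function on the square of the half-plane to `ℂ × ℂ`. -/
def ext2 (f : ℍ × ℍ → ℂ) (p : ℂ × ℂ) : ℂ := f (ofComplex p.1, ofComplex p.2)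

theorem ext2_coe (f : ℍ × ℍ → ℂ) (p : ℍ × ℍ) : ext2 f (p.1, p.2) = f p := by
  simp [ext2, ofComplex_apply]

/-- The square of the half-plane inside `ℂ × ℂ`. -/
def uhp2 : Set (ℂ × ℂ) := {p | 0 < p.1.im ∧ 0 < p.2.im}

theorem isOpen_uhp2 : IsOpen uhp2 :=
  (isOpen_lt continuous_const (Complex.continuous_im.comp continuous_fst)).inter
    (isOpen_lt continuous_const (Complex.continuous_im.comp continuous_snd))

theorem isOpen_uhp : IsOpen {z : ℂ | 0 < z.im} :=
  isOpen_lt continuous_const Complex.continuous_im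

theorem coe_mem_uhp2 (p : ℍ × ℍ) : ((p.1 : ℂ), (p.2 : ℂ)) ∈ uhp2 := ⟨p.1.2, p.2.2⟩

theorem ofComplex_coe {z : ℂ} (hz : 0 < z.im) : ((ofComplex z : ℍ) : ℂ) = z := by
  rw [ofComplex_apply_of_im_pos hz]

theorem hasDerivAt_coe (z : ℍ) :
    HasDerivAt (fun w : ℂ => ((ofComplex w : ℍ) : ℂ)) 1 (z : ℂ) := by
  refine (hasDerivAt_id (z : ℂ)).congr_of_eventuallyEq ?_
  filter_upwards [isOpen_uhp.mem_nhds z.2] with w hw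
  exact ofComplex_coe hw

/-- The linear form on `ℂ × ℂ` with given coefficients. -/
def form (a b : ℂ) : ℂ × ℂ →L[ℂ] ℂ :=
  a • ContinuousLinearMap.fst ℂ ℂ ℂ + b • ContinuousLinearMap.snd ℂ ℂ ℂ

@[simp] theorem form_apply (a b : ℂ) (v : ℂ × ℂ) : form a b v = a * v.1 + b * v.2 := rfl

theorem form_eq (L : ℂ × ℂ →L[ℂ] ℂ) : L = form (L (1, 0)) (L (0, 1)) := by
  ext <;> simp

/-- `f` is differentiable with partial derivatives `f₁` and `f₂`. -/
def HasPartials (f f₁ f₂ : ℍ × ℍ → ℂ) : Prop :=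
  ∀ p : ℍ × ℍ, HasFDerivAt (ext2 f) (form (f₁ p) (f₂ p)) ((p.1 : ℂ), (p.2 : ℂ))

namespace HasPartials

variable {f f₁ f₂ g g₁ g₂ : ℍ × ℍ → ℂ}

theorem mem (h : HasPartials f f₁ f₂) : f ∈ HolUHP2 := by
  intro p hp
  have := h (⟨p.1, hp.1⟩, ⟨p.2, hp.2⟩)
  exact this.differentiableAt.differentiableWithinAt

theorem hasDerivAt_left (h : HasPartials f f₁ f₂) (p : ℍ × ℍ) :
    HasDerivAt (fun w : ℂ => f (ofComplex w, p.2)) (f₁ p) (p.1 : ℂ) := by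
  have := (h p).comp_hasDerivAt (p.1 : ℂ)
    ((hasDerivAt_id (p.1 : ℂ)).prodMk (hasDerivAt_const (p.1 : ℂ) (p.2 : ℂ)))
  simpa [ext2, Function.comp_def, ofComplex_apply] using this

theorem hasDerivAt_right (h : HasPartials f f₁ f₂) (p : ℍ × ℍ) :
    HasDerivAt (fun w : ℂ => f (p.1, ofComplex w)) (f₂ p) (p.2 : ℂ) := by
  have := (h p).comp_hasDerivAt (p.2 : ℂ)
    ((hasDerivAt_const (p.2 : ℂ) (p.1 : ℂ)).prodMk (hasDerivAt_id (p.2 : ℂ)))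
  simpa [ext2, Function.comp_def, ofComplex_apply] using this

theorem hasDerivAt_diag (h : HasPartials f f₁ f₂) (z : ℍ) :
    HasDerivAt (fun w : ℂ => f (ofComplex w, ofComplex w)) (f₁ (z, z) + f₂ (z, z)) (z : ℂ) := by
  have hd := (hasDerivAt_id (z : ℂ)).prodMk (hasDerivAt_id (z : ℂ))
  have hz : HasFDerivAt (ext2 f) (form (f₁ (z, z)) (f₂ (z, z)))
    ((fun w : ℂ => (id w, id w)) (z : ℂ)) := h (z, z)
  have := HasFDerivAt.comp_hasDerivAt (f := fun w : ℂ => (id w, id w)) (z : ℂ) hz hd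
  simpa [ext2, Function.comp_def] using this

theorem partial1_eq (h : HasPartials f f₁ f₂) : partial1 f = f₁ :=
  funext fun p => (h.hasDerivAt_left p).deriv

theorem partial2_eq (h : HasPartials f f₁ f₂) : partial2 f = f₂ :=
  funext fun p => (h.hasDerivAt_right p).deriv

theorem congr (h : HasPartials f f₁ f₂) (h₁ : ∀ p, f₁ p = g₁ p) (h₂ : ∀ p, f₂ p = g₂ p) :
    HasPartials f g₁ g₂ := by
  rwa [← funext h₁, ← funext h₂]

theorem const (c : ℂ) : HasPartials (fun _ => c) (fun _ => 0) (fun _ => 0) := by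
  intro p
  have : form 0 0 = 0 := by ext <;> simp
  simp only [this]
  exact hasFDerivAt_const c _

theorem add (hf : HasPartials f f₁ f₂) (hg : HasPartials g g₁ g₂) :
    HasPartials (fun p => f p + g p) (fun p => f₁ p + g₁ p) (fun p => f₂ p + g₂ p) := by
  intro p
  refine ((hf p).add (hg p)).congr_fderiv ?_
  ext <;> simp

theorem mul (hf : HasPartials f f₁ f₂) (hg : HasPartials g g₁ g₂) :
    HasPartials (fun p => f p * g p) (fun p => f₁ p * g p + f p * g₁ p)
      (fun p => f₂ p * g p + f p * g₂ p) := by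
  intro p
  refine ((hf p).mul (hg p)).congr_fderiv ?_
  ext <;> simp [ext2_coe] <;> ring

theorem const_mul (c : ℂ) (hf : HasPartials f f₁ f₂) :
    HasPartials (fun p => c * f p) (fun p => c * f₁ p) (fun p => c * f₂ p) :=
  ((const c).mul hf).congr (by simp) (by simp)

theorem sub (hf : HasPartials f f₁ f₂) (hg : HasPartials g g₁ g₂) :
    HasPartials (fun p => f p - g p) (fun p => f₁ p - g₁ p) (fun p => f₂ p - g₂ p) := by
  intro p
  refine ((hf p).sub (hg p)).congr_fderiv ?_
  ext <;> simp

/-- Functions of the first variable only. -/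
theorem of_left {u u' : ℍ → ℂ} (h : ∀ z : ℍ, HasDerivAt (fun w : ℂ => u (ofComplex w)) (u' z) z) :
    HasPartials (fun p => u p.1) (fun p => u' p.1) (fun _ => 0) := by
  intro p
  have := (h p.1).hasFDerivAt.comp (x := ((p.1 : ℂ), (p.2 : ℂ))) (f := Prod.fst) hasFDerivAt_fst
  refine this.congr_fderiv ?_
  ext <;> simp

/-- Functions of the second variable only. -/
theorem of_right {u u' : ℍ → ℂ}
    (h : ∀ z : ℍ, HasDerivAt (fun w : ℂ => u (ofComplex w)) (u' z) z) :
    HasPartials (fun p => u p.2) (fun _ => 0) (fun p => u' p.2) := by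
  intro p
  have := (h p.2).hasFDerivAt.comp (x := ((p.1 : ℂ), (p.2 : ℂ))) (f := Prod.snd) hasFDerivAt_snd
  refine this.congr_fderiv ?_
  ext <;> simp

theorem fst : HasPartials (fun p => (p.1 : ℂ)) (fun _ => 1) (fun _ => 0) :=
  of_left (u := fun z => (z : ℂ)) (u' := fun _ => 1) hasDerivAt_coe

theorem snd : HasPartials (fun p => (p.2 : ℂ)) (fun _ => 0) (fun _ => 1) :=
  of_right (u := fun z => (z : ℂ)) (u' := fun _ => 1) hasDerivAt_coe

theorem sub_pow (n : ℕ) : HasPartials (fun p => ((p.1 : ℂ) - p.2) ^ n)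
    (fun p => n * ((p.1 : ℂ) - p.2) ^ (n - 1)) (fun p => -(n * ((p.1 : ℂ) - p.2) ^ (n - 1))) := by
  induction n with
  | zero => simpa using const 1
  | succ n ih =>
    simp only [pow_succ]
    -- The exponent `n - 1` is truncated, so `n = 0` is separate.
    refine (ih.mul (fst.sub snd)).congr ?_ ?_ <;> intro p <;> rcases n with _ | n <;>
      simp <;> ring

end HasPartials

section Hol

variable {f g : ℍ × ℍ → ℂ}

theorem analyticOnNhd_ext2 (hf : f ∈ HolUHP2) : AnalyticOnNhd ℂ (ext2 f) uhp2 :=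
  analyticOnNhd_of_differentiableOn isOpen_uhp2 hf

theorem hasPartials (hf : f ∈ HolUHP2) : HasPartials f (partial1 f) (partial2 f) := by
  have key : HasPartials f (fun p => fderiv ℂ (ext2 f) (p.1, p.2) (1, 0))
      (fun p => fderiv ℂ (ext2 f) (p.1, p.2) (0, 1)) := by
    intro p
    rw [← form_eq]
    exact ((analyticOnNhd_ext2 hf) _ (coe_mem_uhp2 p)).differentiableAt.hasFDerivAt
  rwa [key.partial1_eq, key.partial2_eq]

theorem ext2_partial1 (hf : f ∈ HolUHP2) {q : ℂ × ℂ} (hq : q ∈ uhp2) :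
    ext2 (partial1 f) q = fderiv ℂ (ext2 f) q (1, 0) := by
  have := hasPartials hf (⟨q.1, hq.1⟩, ⟨q.2, hq.2⟩)
  simp only at this
  rw [this.fderiv, ext2, ofComplex_apply_of_im_pos hq.1, ofComplex_apply_of_im_pos hq.2]
  simp

theorem ext2_partial2 (hf : f ∈ HolUHP2) {q : ℂ × ℂ} (hq : q ∈ uhp2) :
    ext2 (partial2 f) q = fderiv ℂ (ext2 f) q (0, 1) := by
  have := hasPartials hf (⟨q.1, hq.1⟩, ⟨q.2, hq.2⟩)
  simp only at this
  rw [this.fderiv, ext2, ofComplex_apply_of_im_pos hq.1, ofComplex_apply_of_im_pos hq.2]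
  simp

/-- Analyticity is what makes the derivative differentiable again; closure of `HolUHP2` under both
partial derivatives follows. -/
theorem differentiableOn_fderiv_apply (hf : f ∈ HolUHP2) (v : ℂ × ℂ) :
    DifferentiableOn ℂ (fun q => fderiv ℂ (ext2 f) q v) uhp2 :=
  (analyticOnNhd_ext2 hf).fderiv.differentiableOn.clm_apply (differentiableOn_const v)

theorem partial1_mem (hf : f ∈ HolUHP2) : partial1 f ∈ HolUHP2 :=
  (differentiableOn_fderiv_apply hf (1, 0)).congr fun _ hq => ext2_partial1 hf hq

theorem partial2_mem (hf : f ∈ HolUHP2) : partial2 f ∈ HolUHP2 :=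
  (differentiableOn_fderiv_apply hf (0, 1)).congr fun _ hq => ext2_partial2 hf hq

theorem partial_comm (hf : f ∈ HolUHP2) : partial1 (partial2 f) = partial2 (partial1 f) := by
  funext p
  have hp := coe_mem_uhp2 p
  have han := analyticOnNhd_ext2 hf _ hp
  have hd : DifferentiableAt ℂ (fderiv ℂ (ext2 f)) ((p.1 : ℂ), (p.2 : ℂ)) :=
    han.fderiv.differentiableAt
  have hsymm : IsSymmSndFDerivAt ℂ (ext2 f) ((p.1 : ℂ), (p.2 : ℂ)) :=
    han.contDiffAt.isSymmSndFDerivAt_of_omega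
  have e1 : ext2 (partial1 f) =ᶠ[𝓝 ((p.1 : ℂ), (p.2 : ℂ))] fun q => fderiv ℂ (ext2 f) q (1, 0) := by
    filter_upwards [isOpen_uhp2.mem_nhds hp] with q hq using ext2_partial1 hf hq
  have e2 : ext2 (partial2 f) =ᶠ[𝓝 ((p.1 : ℂ), (p.2 : ℂ))] fun q => fderiv ℂ (ext2 f) q (0, 1) := by
    filter_upwards [isOpen_uhp2.mem_nhds hp] with q hq using ext2_partial2 hf hq
  rw [← ext2_coe (partial1 _), ← ext2_coe (partial2 _), ext2_partial1 (partial2_mem hf) hp,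
    ext2_partial2 (partial1_mem hf) hp, e1.fderiv_eq, e2.fderiv_eq,
    fderiv_clm_apply hd (by fun_prop), fderiv_clm_apply hd (by fun_prop)]
  simpa using hsymm (1, 0) (0, 1)

theorem partial1_iterate_mem (hf : f ∈ HolUHP2) (n : ℕ) : partial1^[n] f ∈ HolUHP2 := by
  induction n with
  | zero => exact hf
  | succ n ih => rw [Function.iterate_succ_apply']; exact partial1_mem ih

theorem partial2_iterate_mem (hf : f ∈ HolUHP2) (n : ℕ) : partial2^[n] f ∈ HolUHP2 := by
  induction n with
  | zero => exact hf
  | succ n ih => rw [Function.iterate_succ_apply']; exact partial2_mem ih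

theorem partial2_partial1_iterate (hf : f ∈ HolUHP2) (n : ℕ) :
    partial2 (partial1^[n] f) = partial1^[n] (partial2 f) := by
  induction n with
  | zero => rfl
  | succ n ih =>
    rw [Function.iterate_succ_apply', Function.iterate_succ_apply',
      ← partial_comm (partial1_iterate_mem hf n), ih]

theorem sub_mem_hol (hf : f ∈ HolUHP2) (hg : g ∈ HolUHP2) : f - g ∈ HolUHP2 :=
  ((hasPartials hf).sub (hasPartials hg)).mem

theorem diag_mem (hf : f ∈ HolUHP2) : (fun z => f (z, z)) ∈ HolUHP := fun z hz =>
  ((hasPartials hf).hasDerivAt_diag ⟨z, hz⟩).differentiableAt.differentiableWithinAt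

theorem opP_sub (l₁ l₂ : ℂ) (hf : f ∈ HolUHP2) (hg : g ∈ HolUHP2) (p : ℍ × ℍ) :
    opP l₁ l₂ (f - g) p = opP l₁ l₂ f p - opP l₁ l₂ g p := by
  have h := (hasPartials hf).sub (hasPartials hg)
  have h' := (hasPartials (partial2_mem hf)).sub (hasPartials (partial2_mem hg))
  have e : f - g = fun p => f p - g p := rfl
  simp only [opP, e, h.partial1_eq, h.partial2_eq, h'.partial1_eq]
  ring

end Hol

/-- The diagonal Casimir operator is an affine function of `P`. -/
theorem diagCasimir_eq (l₁ l₂ : ℂ) {f : ℍ × ℍ → ℂ} (hf : f ∈ HolUHP2) (p : ℍ × ℍ) :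
    diagCasimir l₁ l₂ f p =
      -(1 / 2) * opP l₁ l₂ f p + (1 / 8) * (l₁ + l₂) * (l₁ + l₂ - 2) * f p := by
  have h := hasPartials hf
  have h1 := hasPartials (partial1_mem hf)
  have h2 := hasPartials (partial2_mem hf)
  have hc := congrFun (partial_comm hf) p
  have H (F : ℍ × ℍ → ℂ) (q : ℍ × ℍ) : diagAct (dpiH l₁) (dpiH l₂) F q =
    (-l₁ * F q - 2 * (q.1 : ℂ) * partial1 F q) + (-l₂ * F q - 2 * (q.2 : ℂ) * partial2 F q) := rfl
  have X (F : ℍ × ℍ → ℂ) (q : ℍ × ℍ) : diagAct dpiX dpiX F q =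
    -partial1 F q + -partial2 F q := rfl
  have Y (F : ℍ × ℍ → ℂ) (q : ℍ × ℍ) : diagAct (dpiY l₁) (dpiY l₂) F q =
    (l₁ * (q.1 : ℂ) * F q + (q.1 : ℂ) ^ 2 * partial1 F q) +
      (l₂ * (q.2 : ℂ) * F q + (q.2 : ℂ) ^ 2 * partial2 F q) := rfl
  have hH := (((h.const_mul (-l₁)).sub ((HasPartials.fst.const_mul 2).mul h1))).add
    ((h.const_mul (-l₂)).sub ((HasPartials.snd.const_mul 2).mul h2))
  have hX := (h1.const_mul (-1)).add (h2.const_mul (-1))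
  have hY := (((HasPartials.fst.const_mul l₁).mul h).add
    ((HasPartials.fst.mul HasPartials.fst).mul h1)).add
    (((HasPartials.snd.const_mul l₂).mul h).add
    ((HasPartials.snd.mul HasPartials.snd).mul h2))
  have eH : diagAct (dpiH l₁) (dpiH l₂) f = _ := funext (H f)
  have eX : diagAct dpiX dpiX f = fun q => -1 * partial1 f q + -1 * partial2 f q := by
    funext q; rw [X]; ring
  have eY : diagAct (dpiY l₁) (dpiY l₂) f = fun q =>
    (l₁ * (q.1 : ℂ) * f q + (q.1 : ℂ) * (q.1 : ℂ) * partial1 f q) +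
      (l₂ * (q.2 : ℂ) * f q + (q.2 : ℂ) * (q.2 : ℂ) * partial2 f q) := by
    funext q; rw [Y]; ring
  simp only [diagCasimir]
  rw [H, X, Y, eH, eX, eY, hH.partial1_eq, hH.partial2_eq, hX.partial1_eq, hX.partial2_eq,
    hY.partial1_eq, hY.partial2_eq]
  simp only [opP, ← hc]
  ring

/-- Intertwining of `P` with multiplication by a power of `ζ₁ - ζ₂`. -/
theorem opP_sub_pow_mul (l₁ l₂ : ℂ) (ℓ : ℕ) {h : ℍ × ℍ → ℂ} (hh : h ∈ HolUHP2) (p : ℍ × ℍ) :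
    opP l₁ l₂ (fun p => ((p.1 : ℂ) - p.2) ^ ℓ * h p) p =
      ((p.1 : ℂ) - p.2) ^ ℓ * (eigenval l₁ l₂ ℓ * h p + opP (l₁ + ℓ) (l₂ + ℓ) h p) := by
  have H := hasPartials hh
  have H2 := hasPartials (partial2_mem hh)
  have A := (HasPartials.sub_pow ℓ).mul H
  have B := ((((HasPartials.sub_pow (ℓ - 1)).const_mul (-(ℓ : ℂ))).mul H).add
    ((HasPartials.sub_pow ℓ).mul H2))
  have e : partial2 (fun p => ((p.1 : ℂ) - p.2) ^ ℓ * h p) =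
      fun p => -(ℓ : ℂ) * ((p.1 : ℂ) - p.2) ^ (ℓ - 1) * h p +
        ((p.1 : ℂ) - p.2) ^ ℓ * partial2 h p := by
    rw [A.partial2_eq]; funext q; ring
  simp only [opP, eigenval]
  rw [e, B.partial1_eq, A.partial1_eq]
  -- Two derivatives lower the exponent to the truncated `ℓ - 1 - 1`, so `ℓ = 0` and `ℓ = 1` are
  -- separate.
  rcases ℓ with _ | _ | n
  · simp
  · simp; ring
  · simp only [Nat.add_sub_cancel, pow_succ]
    push_cast
    ring

theorem sub_pow_mul_mem_Sol {l₁ l₂ : ℂ} {ℓ : ℕ} {h : ℍ × ℍ → ℂ} (hh : h ∈ HolUHP2)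
    (hP : ∀ p, opP (l₁ + ℓ) (l₂ + ℓ) h p = 0) :
    (fun p : ℍ × ℍ => ((p.1 : ℂ) - p.2) ^ ℓ * h p) ∈ Sol l₁ l₂ (eigenval l₁ l₂ ℓ) := by
  refine ⟨((HasPartials.sub_pow ℓ).mul (hasPartials hh)).mem, fun p => ?_⟩
  rw [opP_sub_pow_mul l₁ l₂ ℓ hh, hP]
  ring

theorem add_I_mem_slitPlane (z : ℍ) : (z : ℂ) + Complex.I ∈ Complex.slitPlane := by
  right
  have := z.im_pos
  simp only [Complex.add_im, Complex.I_im, coe_im]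
  linarith

theorem hasDerivAt_cpow_add_I (c : ℂ) (z : ℍ) :
    HasDerivAt (fun w : ℂ => (((ofComplex w : ℍ) : ℂ) + Complex.I) ^ c)
      (c * ((z : ℂ) + Complex.I) ^ (c - 1)) (z : ℂ) := by
  have := ((hasDerivAt_coe z).add_const Complex.I).cpow_const (c := c)
    (by rw [ofComplex_apply]; exact add_I_mem_slitPlane z)
  simpa [ofComplex_apply] using this

/-- Once `(ζ₁ - ζ₂)^ℓ` is split off, the first-order terms cancel the second-order one because
`1/(ζ₁+i) - 1/(ζ₂+i) = -(ζ₁-ζ₂)/((ζ₁+i)(ζ₂+i))`. -/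
theorem minKType_mem_Sol (l₁ l₂ : ℂ) (ℓ : ℕ) :
    minKType l₁ l₂ ℓ ∈ Sol l₁ l₂ (eigenval l₁ l₂ ℓ) := by
  have e : minKType l₁ l₂ ℓ = fun p => ((p.1 : ℂ) - p.2) ^ ℓ *
      (((p.1 : ℂ) + Complex.I) ^ (-l₁ - (ℓ : ℂ)) * ((p.2 : ℂ) + Complex.I) ^ (-l₂ - (ℓ : ℂ))) := by
    funext p; rw [minKType, mul_assoc]
  have L (c : ℂ) := HasPartials.of_left (u := fun z => ((z : ℂ) + Complex.I) ^ c)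
    (hasDerivAt_cpow_add_I c)
  have R (c : ℂ) := HasPartials.of_right (u := fun z => ((z : ℂ) + Complex.I) ^ c)
    (hasDerivAt_cpow_add_I c)
  have h := (L (-l₁ - (ℓ : ℂ))).mul (R (-l₂ - (ℓ : ℂ)))
  rw [e]
  refine sub_pow_mul_mem_Sol h.mem fun p => ?_
  have h2 := (L (-l₁ - (ℓ : ℂ))).mul ((R (-l₂ - (ℓ : ℂ) - 1)).const_mul (-l₂ - (ℓ : ℂ)))
  simp only [opP]
  rw [h.partial1_eq, h.partial2_eq]
  simp only [zero_mul, zero_add, mul_zero, add_zero]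
  rw [h2.partial1_eq]
  have s1 := Complex.slitPlane_ne_zero (add_I_mem_slitPlane p.1)
  have s2 := Complex.slitPlane_ne_zero (add_I_mem_slitPlane p.2)
  simp only [mul_zero, add_zero]
  rw [Complex.cpow_sub _ _ s1, Complex.cpow_sub _ _ s2, Complex.cpow_one, Complex.cpow_one]
  field_simp
  ring

theorem minKType_ne_zero (l₁ l₂ : ℂ) (ℓ : ℕ) : minKType l₁ l₂ ℓ ≠ 0 := by
  let w : ℍ := ⟨2 * Complex.I, by simp⟩
  intro h
  have := congrFun h (I, w)
  have s1 := Complex.slitPlane_ne_zero (add_I_mem_slitPlane I)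
  have s2 := Complex.slitPlane_ne_zero (add_I_mem_slitPlane w)
  have s3 : ((I : ℍ) : ℂ) - (w : ℂ) ≠ 0 := by
    intro h
    have := congrArg Complex.im h
    simp [w] at this
    norm_num at this
  refine mul_ne_zero (mul_ne_zero (pow_ne_zero _ s3) ?_) ?_ this
  · simp only [Complex.cpow_def_of_ne_zero s1]; exact Complex.exp_ne_zero _
  · simp only [Complex.cpow_def_of_ne_zero s2]; exact Complex.exp_ne_zero _

end Calculus

/-! ### Order of vanishing along the diagonal. -/

section Vanishing

open UpperHalfPlane Metric Filter Topology

section Diagonal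

variable {f g : ℍ × ℍ → ℂ}

theorem partial1_add_partial2_diag (hf : f ∈ HolUHP2) (h : ∀ z, f (z, z) = 0) (z : ℍ) :
    partial1 f (z, z) + partial2 f (z, z) = 0 := by
  have h1 := (hasPartials hf).hasDerivAt_diag z
  simp only [h] at h1
  exact h1.unique (hasDerivAt_const _ _)

/-- Derivatives of order below `ℓ` vanish on the diagonal, hence so do their derivatives along it:
each `∂₂` may be traded for `-∂₁`. -/
theorem partial1_iterate_partial2_iterate_diag (hf : f ∈ HolUHP2) {ℓ : ℕ}
    (h : ∀ j < ℓ, ∀ z, partial1^[j] f (z, z) = 0) (b a : ℕ) (hab : a + b ≤ ℓ) (z : ℍ) :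
    partial1^[a] (partial2^[b] f) (z, z) = (-1) ^ b * partial1^[a + b] f (z, z) := by
  induction b generalizing a z with
  | zero => simp
  | succ b ih =>
    have hb := partial2_iterate_mem hf b
    have hG : partial1^[a] (partial2^[b] f) ∈ HolUHP2 := partial1_iterate_mem hb a
    have h0 : ∀ z, partial1^[a] (partial2^[b] f) (z, z) = 0 := fun z => by
      rw [ih a (by omega), h (a + b) (by omega), mul_zero]
    have h1 := partial1_add_partial2_diag hG h0 z
    rw [partial2_partial1_iterate hb, ← Function.iterate_succ_apply' partial1,
      ← Function.iterate_succ_apply' partial2, ih (a + 1) (by omega)] at h1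
    rw [show a + (b + 1) = a + 1 + b by ring]
    linear_combination h1

theorem partial1_iterate_add (hf : f ∈ HolUHP2) (hg : g ∈ HolUHP2) (n : ℕ) :
    partial1^[n] (fun p => f p + g p) = fun p => partial1^[n] f p + partial1^[n] g p := by
  induction n with
  | zero => rfl
  | succ n ih =>
    simp only [Function.iterate_succ_apply', ih]
    exact ((hasPartials (partial1_iterate_mem hf n)).add
      (hasPartials (partial1_iterate_mem hg n))).partial1_eq

theorem partial1_iterate_const_mul (hf : f ∈ HolUHP2) (c : ℂ) (n : ℕ) :
    partial1^[n] (fun p => c * f p) = fun p => c * partial1^[n] f p := by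
  induction n with
  | zero => rfl
  | succ n ih =>
    simp only [Function.iterate_succ_apply', ih]
    exact ((hasPartials (partial1_iterate_mem hf n)).const_mul c).partial1_eq

theorem sub_mul_mem (hf : f ∈ HolUHP2) : (fun p => ((p.1 : ℂ) - p.2) * f p) ∈ HolUHP2 :=
  ((HasPartials.fst.sub HasPartials.snd).mul (hasPartials hf)).mem

theorem partial1_iterate_sub_mul (hf : f ∈ HolUHP2) (n : ℕ) :
    partial1^[n] (fun p => ((p.1 : ℂ) - p.2) * f p) =
      fun p => n * partial1^[n - 1] f p + ((p.1 : ℂ) - p.2) * partial1^[n] f p := by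
  induction n with
  | zero => simp
  | succ n ih =>
    rw [Function.iterate_succ_apply', ih]
    have h := ((hasPartials (partial1_iterate_mem hf (n - 1))).const_mul (n : ℂ)).add
      ((HasPartials.fst.sub HasPartials.snd).mul (hasPartials (partial1_iterate_mem hf n)))
    rw [h.partial1_eq]
    funext p
    rcases n with _ | n
    · simp
    · simp only [Nat.add_sub_cancel, Function.iterate_succ_apply']
      push_cast
      ring

theorem partial1_iterate_sub_mul_diag (hf : f ∈ HolUHP2) (n : ℕ) (z : ℍ) :
    partial1^[n] (fun p => ((p.1 : ℂ) - p.2) * f p) (z, z) = n * partial1^[n - 1] f (z, z) := by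
  rw [partial1_iterate_sub_mul hf]
  simp

theorem partial1_iterate_sub_pow_mul_diag (hf : f ∈ HolUHP2) (ℓ k : ℕ) (hk : k ≤ ℓ) (z : ℍ) :
    partial1^[k] (fun p => ((p.1 : ℂ) - p.2) ^ ℓ * f p) (z, z) =
      if k = ℓ then ℓ.factorial * f (z, z) else 0 := by
  induction ℓ generalizing k with
  | zero =>
    obtain rfl : k = 0 := by omega
    simp
  | succ ℓ ih =>
    have e : (fun p : ℍ × ℍ => ((p.1 : ℂ) - p.2) ^ (ℓ + 1) * f p) =
        fun p => ((p.1 : ℂ) - p.2) * (((p.1 : ℂ) - p.2) ^ ℓ * f p) := by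
      funext p; ring
    rw [e, partial1_iterate_sub_mul_diag ((HasPartials.sub_pow ℓ).mul (hasPartials hf)).mem,
      ih (k - 1) (by omega)]
    rcases k with _ | k
    · simp
    · simp only [Nat.add_sub_cancel, Nat.add_right_cancel_iff, mul_ite, mul_zero]
      split_ifs with h
      · rw [h, Nat.factorial_succ]; push_cast; ring
      · rfl

/-- Each slice `f (·, w)` vanishes to infinite order at `w`, and the half-plane is connected. -/
theorem eq_zero_of_partial1_iterate_diag (hf : f ∈ HolUHP2)
    (h : ∀ k, ∀ z, partial1^[k] f (z, z) = 0) : f = 0 := by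
  funext ⟨a, w⟩
  let F : ℂ → ℂ := fun z => f (ofComplex z, w)
  have hF : AnalyticOnNhd ℂ F {z : ℂ | 0 < z.im} := by
    refine DifferentiableOn.analyticOnNhd (fun z hz => ?_) isOpen_uhp
    exact ((hasPartials hf).hasDerivAt_left
      (⟨z, hz⟩, w)).differentiableAt.differentiableWithinAt
  have hit : ∀ k, ∀ z : ℍ, iteratedDeriv k F z = partial1^[k] f (z, w) := by
    intro k
    induction k with
    | zero => intro z; simp [F, ofComplex_apply]
    | succ k ih =>
      intro z
      rw [iteratedDeriv_succ, Function.iterate_succ_apply']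
      refine HasDerivAt.deriv ?_
      refine ((hasPartials (partial1_iterate_mem hf k)).hasDerivAt_left
        (z, w)).congr_of_eventuallyEq ?_
      filter_upwards [isOpen_uhp.mem_nhds z.2] with u hu
      rw [← ih, ofComplex_coe hu]
  have htop : analyticOrderAt F w = ⊤ := by
    rw [ENat.eq_top_iff_forall_ge]
    intro n
    rw [natCast_le_analyticOrderAt_iff_iteratedDeriv_eq_zero (hF w w.2)]
    intro i _
    rw [hit, h]
  rw [analyticOrderAt_eq_top] at htop
  have hconv : Convex ℝ {z : ℂ | 0 < z.im} := convex_halfSpace_im_gt 0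
  have := hF.eqOn_zero_of_preconnected_of_eventuallyEq_zero hconv.isPreconnected w.2 htop a.2
  simpa [F, ofComplex_apply] using this

/-- Evaluating the equation `P f = μ f` to the order of vanishing along the diagonal. -/
theorem mul_partial1_iterate_diag {l₁ l₂ μ : ℂ} (hf : f ∈ Sol l₁ l₂ μ) {k : ℕ}
    (h : ∀ j < k, ∀ z, partial1^[j] f (z, z) = 0) (z : ℍ) :
    μ * partial1^[k] f (z, z) = eigenval l₁ l₂ k * partial1^[k] f (z, z) := by
  obtain ⟨hf, hP⟩ := hf
  have h1 := partial1_mem hf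
  have h2 := partial2_mem hf
  have h12 := partial1_mem h2
  have hA := sub_mul_mem h12
  have hB := ((hasPartials h1).const_mul (-l₂)).mem
  have hC := ((hasPartials h2).const_mul l₁).mem
  have hAB := ((hasPartials hA).add (hasPartials hB)).mem
  have hG := ((hasPartials hAB).add (hasPartials hC)).mem
  -- One factor `ζ₁ - ζ₂` is common to all terms of `P`. On the diagonal it absorbs one of the `k`
  -- derivatives, leaving `k` times the derivative of order `k - 1` of the bracket.
  have e : (fun p => μ * f p) = fun p => ((p.1 : ℂ) - p.2) *
      (((p.1 : ℂ) - p.2) * partial1 (partial2 f) p + -l₂ * partial1 f p + l₁ * partial2 f p) := by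
    funext p
    rw [← hP p, opP]
    ring
  have := congrFun (partial1_iterate_const_mul hf μ k) (z, z)
  rw [e, partial1_iterate_sub_mul_diag hG, partial1_iterate_add hAB hC,
    partial1_iterate_add hA hB, partial1_iterate_const_mul h1, partial1_iterate_const_mul h2] at this
  rw [← this]
  simp only [partial1_iterate_sub_mul_diag h12]
  rcases k with _ | k
  · simp [eigenval]
  -- With `k + 1` the order of vanishing, all terms become multiples of `∂₁^(k+1) f`, with total
  -- coefficient `-(k + 1) (k + l₁ + l₂)`.
  have hm := partial1_iterate_partial2_iterate_diag hf h 1 k le_rfl z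
  simp only [Nat.add_sub_cancel, Function.iterate_one, pow_one] at hm ⊢
  rw [hm, ← Function.iterate_succ_apply partial1 k]
  rcases k with _ | k
  · simp [eigenval]; ring
  · rw [Nat.add_sub_cancel, ← Function.iterate_succ_apply partial1 k, hm]
    simp only [eigenval]
    push_cast
    ring

/-- A nonzero solution has a finite order of vanishing along the diagonal, which determines the
eigenvalue. -/
theorem exists_eigenval_of_ne_zero {l₁ l₂ μ : ℂ} (hf : f ∈ Sol l₁ l₂ μ) (h0 : f ≠ 0) :
    ∃ k : ℕ, μ = eigenval l₁ l₂ k ∧ (∀ j < k, ∀ z, partial1^[j] f (z, z) = 0) ∧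
      ∃ z, partial1^[k] f (z, z) ≠ 0 := by
  classical
  have hex : ∃ k, ∃ z, partial1^[k] f (z, z) ≠ 0 := by
    by_contra! h
    exact h0 (eq_zero_of_partial1_iterate_diag hf.1 h)
  have hmin : ∀ j < Nat.find hex, ∀ z, partial1^[j] f (z, z) = 0 := fun j hj => by
    simpa using Nat.find_min hex hj
  obtain ⟨z, hz⟩ := Nat.find_spec hex
  exact ⟨_, mul_right_cancel₀ hz (mul_partial1_iterate_diag hf hmin z), hmin, z, hz⟩

theorem zero_mem_Sol (l₁ l₂ μ : ℂ) : (0 : ℍ × ℍ → ℂ) ∈ Sol l₁ l₂ μ := by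
  have h : HasPartials (0 : ℍ × ℍ → ℂ) (fun _ => 0) (fun _ => 0) := HasPartials.const 0
  refine ⟨h.mem, fun p => ?_⟩
  rw [opP, h.partial2_eq, h.partial1_eq, (HasPartials.const 0).partial1_eq]
  simp

theorem Sol_ne_zero_iff (l₁ l₂ μ : ℂ) : Sol l₁ l₂ μ ≠ {0} ↔ ∃ ℓ : ℕ, μ = eigenval l₁ l₂ ℓ := by
  constructor
  · intro h
    by_contra hμ
    refine h (Set.eq_singleton_iff_unique_mem.2 ⟨zero_mem_Sol _ _ _, fun f hf => ?_⟩)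
    by_contra h0
    obtain ⟨k, hk, -⟩ := exists_eigenval_of_ne_zero hf h0
    exact hμ ⟨k, hk⟩
  · rintro ⟨ℓ, rfl⟩ h
    have := minKType_mem_Sol l₁ l₂ ℓ
    rw [h] at this
    exact minKType_ne_zero l₁ l₂ ℓ this

/-- This is Chu-Vandermonde for the falling factorials of `x + n - 1` and `y + n - 1`, a falling
factorial of `r` of length `k` being `(r - k + 1)_k`. -/
theorem poch_add (x y : ℂ) (n : ℕ) :
    ∑ j ∈ Finset.range (n + 1), poch (x + n - j) j * poch (y + j) (n - j) /
      ((j.factorial : ℂ) * ((n - j).factorial : ℂ)) = poch (x + y + n - 1) n / n.factorial := by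
  have key (r : ℂ) (k : ℕ) : (descPochhammer ℤ k).smeval r = poch (r - k + 1) k := by
    rw [Polynomial.descPochhammer_smeval_eq_ascPochhammer,
      Polynomial.ascPochhammer_smeval_eq_eval]
    rfl
  have h := Ring.descPochhammer_smeval_add (r := x + n - 1) (s := y + n - 1) n (Commute.all _ _)
  simp only [key] at h
  rw [show x + y + n - 1 = x + n - 1 + (y + n - 1) - n + 1 by ring, h,
    Finset.Nat.sum_antidiagonal_eq_sum_range_succ_mk, Finset.sum_div]
  refine Finset.sum_congr rfl fun j hj => ?_
  have hj : j ≤ n := Nat.lt_succ_iff.1 (Finset.mem_range.1 hj)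
  have hc : (n.choose j : ℂ) * (j.factorial * (n - j).factorial) = n.factorial := by
    rw [← mul_assoc]
    exact_mod_cast Nat.choose_mul_factorial_mul_factorial hj
  have h1 : (n.factorial : ℂ) ≠ 0 := by exact_mod_cast n.factorial_ne_zero
  have h2 : (j.factorial : ℂ) ≠ 0 := by exact_mod_cast j.factorial_ne_zero
  have h3 : ((n - j).factorial : ℂ) ≠ 0 := by exact_mod_cast (n - j).factorial_ne_zero
  rw [div_eq_div_iff (mul_ne_zero h2 h3) h1, ← hc]
  simp only [Nat.cast_sub hj]
  rw [show x + n - 1 - j + 1 = x + n - j by ring, show y + n - 1 - (n - j) + 1 = y + (j : ℂ) by ring]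
  ring

/-- The Rankin-Cohen operator on functions vanishing to order `ℓ` along the diagonal. -/
theorem RC_eq_of_vanishing (l₁ l₂ : ℂ) (hf : f ∈ HolUHP2) {ℓ : ℕ}
    (h : ∀ j < ℓ, ∀ z, partial1^[j] f (z, z) = 0) (z : ℍ) :
    RC l₁ l₂ ℓ f z = poch (l₁ + l₂ + ℓ - 1) ℓ / ℓ.factorial * partial1^[ℓ] f (z, z) := by
  rw [← poch_add, Finset.sum_mul, RC]
  refine Finset.sum_congr rfl fun j hj => ?_
  have hj : j ≤ ℓ := Nat.lt_succ_iff.1 (Finset.mem_range.1 hj)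
  -- The sign from trading `∂₂^j` for `∂₁^j` cancels the alternating sign of `RC`, so the
  -- coefficients add up without signs.
  rw [partial1_iterate_partial2_iterate_diag hf h j (ℓ - j) (by omega), Nat.sub_add_cancel hj]
  have : (-1 : ℂ) ^ j * (-1) ^ j = 1 := by rw [← mul_pow]; simp
  linear_combination (poch (l₁ + ℓ - j) j * poch (l₂ + j) (ℓ - j) /
      ((j.factorial : ℂ) * ((ℓ - j).factorial : ℂ)) * partial1^[ℓ] f (z, z)) * this

theorem RC_mem (l₁ l₂ : ℂ) (ℓ : ℕ) (hf : f ∈ HolUHP2) : RC l₁ l₂ ℓ f ∈ HolUHP := by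
  simp only [HolUHP, Set.mem_ofPred_eq, RC]
  refine DifferentiableOn.fun_sum fun j _ => ?_
  exact (diag_mem (partial1_iterate_mem (partial2_iterate_mem hf j) (ℓ - j))).const_mul _

theorem partial2_iterate_sub (hf : f ∈ HolUHP2) (hg : g ∈ HolUHP2) (n : ℕ) :
    partial2^[n] (f - g) = partial2^[n] f - partial2^[n] g := by
  induction n with
  | zero => rfl
  | succ n ih =>
    simp only [Function.iterate_succ_apply', ih]
    exact ((hasPartials (partial2_iterate_mem hf n)).sub
      (hasPartials (partial2_iterate_mem hg n))).partial2_eq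

theorem partial1_iterate_sub (hf : f ∈ HolUHP2) (hg : g ∈ HolUHP2) (n : ℕ) :
    partial1^[n] (f - g) = partial1^[n] f - partial1^[n] g := by
  induction n with
  | zero => rfl
  | succ n ih =>
    simp only [Function.iterate_succ_apply', ih]
    exact ((hasPartials (partial1_iterate_mem hf n)).sub
      (hasPartials (partial1_iterate_mem hg n))).partial1_eq

theorem RC_sub (l₁ l₂ : ℂ) (ℓ : ℕ) (hf : f ∈ HolUHP2) (hg : g ∈ HolUHP2) :
    RC l₁ l₂ ℓ (f - g) = RC l₁ l₂ ℓ f - RC l₁ l₂ ℓ g := by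
  funext z
  simp only [RC, Pi.sub_apply, ← Finset.sum_sub_distrib]
  refine Finset.sum_congr rfl fun j _ => ?_
  rw [partial2_iterate_sub hf hg,
    partial1_iterate_sub (partial2_iterate_mem hf j) (partial2_iterate_mem hg j), Pi.sub_apply]
  ring

theorem sub_mem_Sol {l₁ l₂ μ : ℂ} (hf : f ∈ Sol l₁ l₂ μ) (hg : g ∈ Sol l₁ l₂ μ) :
    f - g ∈ Sol l₁ l₂ μ := by
  refine ⟨sub_mem_hol hf.1 hg.1, fun p => ?_⟩
  rw [opP_sub l₁ l₂ hf.1 hg.1, hf.2, hg.2, Pi.sub_apply]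
  ring

theorem poch_ne_zero {x : ℂ} (n : ℕ) (hx : 0 < x.re) : poch x n ≠ 0 := by
  rw [poch, Ne, ascPochhammer_eval_eq_zero_iff]
  rintro ⟨k, -, hk⟩
  have := congrArg Complex.re hk
  simp at this
  have : (0 : ℝ) ≤ k := k.cast_nonneg
  linarith

/-- A solution in the kernel of the Rankin-Cohen operator vanishes. -/
theorem eq_zero_of_RC_eq_zero {l₁ l₂ : ℂ} (hl : 0 < (l₁ + l₂).re) {ℓ : ℕ}
    (hf : f ∈ Sol l₁ l₂ (eigenval l₁ l₂ ℓ)) (h : RC l₁ l₂ ℓ f = 0) : f = 0 := by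
  by_contra h0
  obtain ⟨k, hμ, hv, z, hz⟩ := exists_eigenval_of_ne_zero hf h0
  have hkl : k = ℓ := by
    by_contra hne
    -- This is the difference of the two eigenvalues. The second factor has positive real part,
    -- since `k ≠ ℓ` gives `k + ℓ ≥ 1`.
    have hfac : ((k : ℂ) - ℓ) * (l₁ + l₂ + k + ℓ - 1) = 0 := by
      simp only [eigenval] at hμ
      linear_combination hμ
    rcases mul_eq_zero.1 hfac with h | h
    · exact hne (by exact_mod_cast sub_eq_zero.1 h)
    · have hre := congrArg Complex.re h
      simp only [Complex.sub_re, Complex.add_re, Complex.natCast_re, Complex.one_re,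
        Complex.zero_re] at hre hl
      have : (1 : ℝ) ≤ (k : ℝ) + ℓ := by exact_mod_cast (by omega : 1 ≤ k + ℓ)
      linarith
  subst hkl
  have := congrFun h z
  rw [RC_eq_of_vanishing l₁ l₂ hf.1 hv, Pi.zero_apply] at this
  -- For `k = 0` the base may have nonpositive real part, but the symbol is then the empty product.
  have hp : poch (l₁ + l₂ + k - 1) k ≠ 0 := by
    rcases k with _ | k
    · simp [poch]
    · refine poch_ne_zero _ ?_
      simp only [Complex.sub_re, Complex.add_re, Complex.natCast_re, Complex.one_re] at hl ⊢
      push_cast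
      have : (0 : ℝ) ≤ k := k.cast_nonneg
      linarith
  exact mul_ne_zero (div_ne_zero hp (by exact_mod_cast k.factorial_ne_zero)) hz this

end Diagonal

end Vanishing

/-! ### Beta averages over segments and the holographic operator. -/

section Integral

open UpperHalfPlane Metric Filter Topology MeasureTheory
open scoped Interval

/-- The point dividing the segment from `p.1` to `p.2` in the ratio `t : 1 - t`. -/
def seg (p : ℂ × ℂ) (t : ℝ) : ℂ := p.1 * (1 - t) + p.2 * t

theorem seg_im_pos {p : ℂ × ℂ} (hp : p ∈ uhp2) {t : ℝ} (ht : t ∈ Set.Icc (0 : ℝ) 1) :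
    0 < (seg p t).im := by
  have := (convex_halfSpace_im_gt 0) hp.1 hp.2 (sub_nonneg.2 ht.2) ht.1 (by ring)
  simpa [seg, mul_comm] using this

theorem continuous_seg : Continuous fun q : (ℂ × ℂ) × ℝ => seg q.1 q.2 := by
  unfold seg; fun_prop

/-- Weighted average of a function on the half-plane over segments. -/
def avg (G : ℍ → ℂ) (W : ℝ → ℂ) (p : ℍ × ℍ) : ℂ :=
  ∫ t in (0 : ℝ)..1, G (ofComplex (seg (p.1, p.2) t)) * W t

theorem continuousOn_comp_seg {g : ℂ → ℂ} (hg : ContinuousOn g {z : ℂ | 0 < z.im}) {p : ℂ × ℂ}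
    (hp : p ∈ uhp2) : ContinuousOn (fun t : ℝ => g (seg p t)) (Set.uIcc 0 1) := by
  rw [Set.uIcc_of_le zero_le_one]
  exact hg.comp (continuous_seg.comp (by fun_prop : Continuous fun t : ℝ => (p, t))).continuousOn
    fun t ht => seg_im_pos hp ht

theorem diff_mem {G : ℍ → ℂ} (hG : G ∈ HolUHP) : diff G ∈ HolUHP := by
  have : DifferentiableOn ℂ (deriv fun w : ℂ => G (ofComplex w)) {z : ℂ | 0 < z.im} :=
    DifferentiableOn.deriv hG isOpen_uhp
  refine this.congr fun z hz => ?_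
  rw [diff, ofComplex_coe hz]

theorem hasDerivAt_ofComplex {G : ℍ → ℂ} (hG : G ∈ HolUHP) {z : ℂ} (hz : 0 < z.im) :
    HasDerivAt (fun w : ℂ => G (ofComplex w)) (diff G (ofComplex z)) z := by
  have := (DifferentiableOn.differentiableAt hG (isOpen_uhp.mem_nhds hz)).hasDerivAt
  rwa [diff, ofComplex_coe hz]

theorem continuousOn_ofComplex {G : ℍ → ℂ} (hG : G ∈ HolUHP) :
    ContinuousOn (fun w : ℂ => G (ofComplex w)) {z : ℂ | 0 < z.im} :=
  DifferentiableOn.continuousOn hG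

theorem intervalIntegrable_avg {G : ℍ → ℂ} (hG : G ∈ HolUHP) {W : ℝ → ℂ}
    (hW : IntervalIntegrable W volume 0 1) {p : ℂ × ℂ} (hp : p ∈ uhp2) :
    IntervalIntegrable (fun t => G (ofComplex (seg p t)) * W t) volume 0 1 :=
  hW.continuousOn_mul (continuousOn_comp_seg (continuousOn_ofComplex hG) hp)

theorem norm_form_le (a b : ℂ) : ‖form a b‖ ≤ ‖a‖ + ‖b‖ := by
  refine ContinuousLinearMap.opNorm_le_bound _ (by positivity) fun v => ?_
  rw [form_apply, add_mul]
  refine (norm_add_le _ _).trans ?_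
  rw [norm_mul, norm_mul]
  gcongr
  · exact norm_fst_le v
  · exact norm_snd_le v

theorem integral_form {a b : ℝ → ℂ} (ha : IntervalIntegrable a volume 0 1)
    (hb : IntervalIntegrable b volume 0 1) :
    ∫ t in (0 : ℝ)..1, form (a t) (b t) =
      form (∫ t in (0 : ℝ)..1, a t) (∫ t in (0 : ℝ)..1, b t) := by
  simp only [form]
  rw [intervalIntegral.integral_add, intervalIntegral.integral_smul_const, intervalIntegral.integral_smul_const]
  · exact ⟨ha.1.smul_const _, ha.2.smul_const _⟩
  · exact ⟨hb.1.smul_const _, hb.2.smul_const _⟩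

/-- Differentiation under the integral sign; the new weights are the derivatives `1 - t` and `t` of
the segment point in its endpoints. -/
theorem hasPartials_avg {G : ℍ → ℂ} (hG : G ∈ HolUHP) {W : ℝ → ℂ}
    (hW : IntervalIntegrable W volume 0 1) :
    HasPartials (avg G W) (avg (diff G) fun t => (1 - t) * W t)
      (avg (diff G) fun t => t * W t) := by
  intro p
  have hp := coe_mem_uhp2 p
  have hG' := diff_mem hG
  have hW1 : IntervalIntegrable (fun t : ℝ => (1 - (t : ℂ)) * W t) volume 0 1 :=
    hW.continuousOn_mul (by fun_prop)
  have hW2 : IntervalIntegrable (fun t : ℝ => (t : ℂ) * W t) volume 0 1 :=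
    hW.continuousOn_mul (by fun_prop)
  obtain ⟨ε, hε, hsub⟩ := Metric.nhds_basis_closedBall.mem_iff.1 (isOpen_uhp2.mem_nhds hp)
  -- On this compact set `seg` stays in the half-plane, so `diff G` is bounded along it. The
  -- dominating function is then a multiple of `‖W‖`, and `W` may be singular at the endpoints.
  let K : Set ((ℂ × ℂ) × ℝ) := closedBall ((p.1 : ℂ), (p.2 : ℂ)) ε ×ˢ Set.Icc (0 : ℝ) 1
  have hK : IsCompact K := (isCompact_closedBall _ _).prod isCompact_Icc
  have hKc : ContinuousOn (fun q : (ℂ × ℂ) × ℝ => diff G (ofComplex (seg q.1 q.2))) K :=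
    (continuousOn_ofComplex hG').comp continuous_seg.continuousOn
      fun q hq => seg_im_pos (hsub hq.1) hq.2
  obtain ⟨C, hC⟩ := hK.exists_bound_of_continuousOn hKc
  have hsmem : closedBall ((p.1 : ℂ), (p.2 : ℂ)) ε ∈ 𝓝 ((p.1 : ℂ), (p.2 : ℂ)) :=
    closedBall_mem_nhds _ hε
  have hint1 := intervalIntegrable_avg hG' hW1 hp
  have hint2 := intervalIntegrable_avg hG' hW2 hp
  have hIcc {t : ℝ} (ht : t ∈ Ι (0 : ℝ) 1) : t ∈ Set.Icc (0 : ℝ) 1 := by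
    rw [Set.uIoc_of_le zero_le_one] at ht
    exact ⟨ht.1.le, ht.2⟩
  have key := intervalIntegral.hasFDerivAt_integral_of_dominated_of_fderiv_le (𝕜 := ℂ) (μ := volume)
    (F := fun (q : ℂ × ℂ) (t : ℝ) => G (ofComplex (seg q t)) * W t)
    (F' := fun q t => form (diff G (ofComplex (seg q t)) * ((1 - (t : ℂ)) * W t))
      (diff G (ofComplex (seg q t)) * ((t : ℂ) * W t)))
    (x₀ := ((p.1 : ℂ), (p.2 : ℂ))) (a := 0) (b := 1) (bound := fun t => 2 * C * ‖W t‖)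
    hsmem ?_ (intervalIntegrable_avg hG hW hp) ?_ ?_ ?_ ?_
  · rw [integral_form hint1 hint2] at key
    refine key.congr_of_eventuallyEq ?_
    filter_upwards [hsmem] with q hq
    simp only [ext2, avg]
    rw [ofComplex_coe (hsub hq).1, ofComplex_coe (hsub hq).2]
  · filter_upwards [hsmem] with q hq
    exact (intervalIntegrable_avg hG hW (hsub hq)).def'.aestronglyMeasurable
  · have h1 := hint1.def'.aestronglyMeasurable
    have h2 := hint2.def'.aestronglyMeasurable
    exact (h1.smul_const _).add (h2.smul_const _)
  · refine Eventually.of_forall fun t ht q hq => ?_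
    have ht' := hIcc ht
    refine (norm_form_le _ _).trans ?_
    have h1 : ‖(1 - (t : ℂ))‖ ≤ 1 := by
      rw [← Complex.ofReal_one, ← Complex.ofReal_sub, Complex.norm_real, Real.norm_eq_abs, abs_le]
      constructor <;> linarith [ht'.1, ht'.2]
    have h2 : ‖(t : ℂ)‖ ≤ 1 := by
      rw [Complex.norm_real, Real.norm_eq_abs, abs_le]
      constructor <;> linarith [ht'.1, ht'.2]
    have hCq : ‖diff G (ofComplex (seg q t))‖ ≤ C := hC (q, t) ⟨hq, ht'⟩
    have hC0 : 0 ≤ C := (norm_nonneg _).trans hCq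
    calc _ ≤ C * (1 * ‖W t‖) + C * (1 * ‖W t‖) := by
          simp only [norm_mul]
          gcongr
      _ = 2 * C * ‖W t‖ := by ring
  · exact hW.norm.const_mul _
  · refine Eventually.of_forall fun t ht q hq => ?_
    have hd := hasDerivAt_ofComplex hG (seg_im_pos (hsub hq) (hIcc ht))
    have hs : HasFDerivAt (fun q : ℂ × ℂ => seg q t) (form (1 - (t : ℂ)) t) q := by
      refine (form (1 - (t : ℂ)) t).hasFDerivAt.congr_of_eventuallyEq
        (Eventually.of_forall fun q => ?_)
      simp only [seg, form_apply]
      ring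
    refine ((hd.hasFDerivAt.comp q hs).mul_const (W t)).congr_fderiv ?_
    ext <;> simp <;> ring

/-- The density of the beta distribution. -/
def betaWeight (a b : ℂ) (t : ℝ) : ℂ := (t : ℂ) ^ (b - 1) * (1 - (t : ℂ)) ^ (a - 1)

section Beta

variable {a b : ℂ}

theorem intervalIntegrable_betaWeight (ha : 0 < a.re) (hb : 0 < b.re) :
    IntervalIntegrable (betaWeight a b) volume 0 1 :=
  Complex.betaIntegral_convergent hb ha

/-- Valid at the endpoints too: `0 ^ c = 0` for `c ≠ 0`, whereas `0 ^ 0 = 1`. -/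
theorem mul_betaWeight (ha : a ≠ 0) (hb : b ≠ 0) (t : ℝ) :
    (1 - (t : ℂ)) * (t * betaWeight a b t) = (t : ℂ) ^ b * (1 - (t : ℂ)) ^ a := by
  have key (z c : ℂ) (hc : c ≠ 0) : z * z ^ (c - 1) = z ^ c := by
    rcases eq_or_ne z 0 with rfl | hz
    · rw [Complex.zero_cpow hc, zero_mul]
    · rw [Complex.cpow_sub _ _ hz, Complex.cpow_one]; field_simp
  rw [← key t b hb, ← key (1 - t) a ha, betaWeight]
  ring

theorem hasDerivAt_mul_betaWeight {t : ℝ} (ht : t ∈ Set.Ioo (0 : ℝ) 1) :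
    HasDerivAt (fun t : ℝ => (t : ℂ) ^ b * (1 - (t : ℂ)) ^ a)
      (b * ((1 - (t : ℂ)) * betaWeight a b t) - a * (t * betaWeight a b t)) t := by
  have s1 : (t : ℂ) ∈ Complex.slitPlane := Or.inl (by simpa using ht.1)
  have s2 : 1 - (t : ℂ) ∈ Complex.slitPlane := Or.inl (by simpa using ht.2)
  have U := (hasDerivAt_id (t : ℂ)).cpow_const (c := b) s1
  have V := ((hasDerivAt_id (t : ℂ)).const_sub 1).cpow_const (c := a) s2
  have := (U.mul V).comp_ofReal
  refine this.congr_deriv ?_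
  have e1 := Complex.slitPlane_ne_zero s1
  have e2 := Complex.slitPlane_ne_zero s2
  simp only [betaWeight, id]
  rw [Complex.cpow_sub _ _ e1, Complex.cpow_sub _ _ e2, Complex.cpow_one, Complex.cpow_one]
  field_simp
  ring

theorem continuousOn_mul_betaWeight (ha : 0 < a.re) (hb : 0 < b.re) :
    ContinuousOn (fun t : ℝ => (t : ℂ) ^ b * (1 - (t : ℂ)) ^ a) (Set.Icc 0 1) := by
  refine (continuousOn_of_forall_continuousAt fun x hx => ?_).mul
    (continuousOn_of_forall_continuousAt fun x hx => ?_)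
  · refine (Complex.continuousAt_cpow_const_of_re_pos (Or.inl ?_) hb).comp
      Complex.continuous_ofReal.continuousAt
    rw [Complex.ofReal_re]; exact hx.1
  · refine (Complex.continuousAt_cpow_const_of_re_pos (z := 1 - (x : ℂ)) (Or.inl ?_) ha).comp
      (f := fun x : ℝ => 1 - (x : ℂ)) (by fun_prop)
    rw [Complex.sub_re, Complex.one_re, Complex.ofReal_re, sub_nonneg]
    exact hx.2

/-- The averages against the beta density solve the Euler-Poisson-Darboux equation. -/
theorem opP_avg (ha : 0 < a.re) (hb : 0 < b.re) {G : ℍ → ℂ} (hG : G ∈ HolUHP) (p : ℍ × ℍ) :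
    opP a b (avg G (betaWeight a b)) p = 0 := by
  have ha0 : a ≠ 0 := by rintro rfl; simp at ha
  have hb0 : b ≠ 0 := by rintro rfl; simp at hb
  have hp := coe_mem_uhp2 p
  have hG' := diff_mem hG
  have hG'' := diff_mem hG'
  have hW := intervalIntegrable_betaWeight ha hb
  have hW1 : IntervalIntegrable (fun t : ℝ => (1 - (t : ℂ)) * betaWeight a b t) volume 0 1 :=
    hW.continuousOn_mul (by fun_prop)
  have hW2 : IntervalIntegrable (fun t : ℝ => (t : ℂ) * betaWeight a b t) volume 0 1 :=
    hW.continuousOn_mul (by fun_prop)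
  have hW12 : IntervalIntegrable (fun t : ℝ => (1 - (t : ℂ)) * ((t : ℂ) * betaWeight a b t))
    volume 0 1 := hW2.continuousOn_mul (by fun_prop)
  have h := hasPartials_avg hG hW
  have h2 := hasPartials_avg hG' hW2
  simp only [opP]
  rw [h.partial2_eq, h.partial1_eq, h2.partial1_eq]
  have i1 := intervalIntegrable_avg hG' hW1 hp
  have i2 := intervalIntegrable_avg hG' hW2 hp
  have i12 := intervalIntegrable_avg hG'' hW12 hp
  -- `P` of the average is `ζ₂ - ζ₁` times the integral of this derivative.
  have hder : ∀ t ∈ Set.Ioo (0 : ℝ) 1, HasDerivAt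
      (fun t : ℝ => diff G (ofComplex (seg (p.1, p.2) t)) * ((t : ℂ) ^ b * (1 - (t : ℂ)) ^ a))
      (((p.2 : ℂ) - p.1) * (diff (diff G) (ofComplex (seg (p.1, p.2) t)) *
          ((1 - (t : ℂ)) * ((t : ℂ) * betaWeight a b t))) +
        (b * (diff G (ofComplex (seg (p.1, p.2) t)) * ((1 - (t : ℂ)) * betaWeight a b t)) -
        a * (diff G (ofComplex (seg (p.1, p.2) t)) * ((t : ℂ) * betaWeight a b t)))) t := by
    intro t ht
    have hs : HasDerivAt (fun z : ℂ => (p.1 : ℂ) * (1 - z) + p.2 * z) ((p.2 : ℂ) - p.1) (t : ℂ) := by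
      refine ((((hasDerivAt_id (t : ℂ)).const_sub 1).const_mul (p.1 : ℂ)).add
        ((hasDerivAt_id (t : ℂ)).const_mul (p.2 : ℂ))).congr_deriv ?_
      ring
    have hd := hasDerivAt_ofComplex hG' (seg_im_pos hp (Set.Ioo_subset_Icc_self ht))
    have hc := (HasDerivAt.comp (t : ℂ)
      (h := fun z : ℂ => (p.1 : ℂ) * (1 - z) + p.2 * z) hd hs).comp_ofReal
    refine (hc.mul (hasDerivAt_mul_betaWeight ht)).congr_deriv ?_
    rw [mul_betaWeight ha0 hb0]
    simp only [seg, Function.comp]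
    ring
  have hcont : ContinuousOn
      (fun t : ℝ => diff G (ofComplex (seg (p.1, p.2) t)) * ((t : ℂ) ^ b * (1 - (t : ℂ)) ^ a))
      (Set.Icc 0 1) := by
    refine ContinuousOn.mul ?_ (continuousOn_mul_betaWeight ha hb)
    simpa using continuousOn_comp_seg (continuousOn_ofComplex hG') hp
  -- The weight may blow up at the endpoints, so differentiability is used only inside. The
  -- primitive is continuous up to the ends and vanishes there because `a` and `b` have positive
  -- real part.
  have ftc := intervalIntegral.integral_eq_sub_of_hasDerivAt_of_le zero_le_one hcont hder
    ((i12.const_mul _).add ((i1.const_mul _).sub (i2.const_mul _)))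
  rw [intervalIntegral.integral_add (i12.const_mul _) ((i1.const_mul _).sub (i2.const_mul _)),
    intervalIntegral.integral_sub (i1.const_mul _) (i2.const_mul _), intervalIntegral.integral_const_mul, intervalIntegral.integral_const_mul,
    intervalIntegral.integral_const_mul] at ftc
  simp only [Complex.ofReal_one, Complex.ofReal_zero, sub_self, Complex.zero_cpow ha0,
    Complex.zero_cpow hb0, mul_zero, zero_mul] at ftc
  simp only [avg]
  linear_combination -((p.1 : ℂ) - p.2) * ftc

theorem avg_betaWeight_diag (G : ℍ → ℂ) (z : ℍ) :
    avg G (betaWeight a b) (z, z) = Complex.betaIntegral b a * G z := by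
  have (t : ℝ) : seg ((z : ℂ), (z : ℂ)) t = z := by simp only [seg]; ring
  simp only [avg, this, ofComplex_apply, intervalIntegral.integral_const_mul, betaWeight, Complex.betaIntegral]
  exact mul_comm _ _

end Beta

/-- Substitution `v = 2t - 1`: the Jacobian and the powers of `2` from `1 - v` and `1 + v` cancel
the normalising power of `2`. -/
theorem Psi_eq (l₁ l₂ : ℂ) (ℓ : ℕ) (g : ℍ → ℂ) :
    Psi l₁ l₂ ℓ g = fun p => ((p.1 : ℂ) - p.2) ^ ℓ *
      ((ℓ.factorial : ℂ)⁻¹ * avg g (betaWeight (l₁ + ℓ) (l₂ + ℓ)) p) := by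
  funext p
  let F : ℝ → ℂ := fun v =>
    g (ofComplex ((((p.2 : ℂ) - p.1) * (v : ℂ) + ((p.1 : ℂ) + p.2)) / 2)) *
      ((1 - v : ℝ) : ℂ) ^ (l₁ + (ℓ : ℂ) - 1) * ((1 + v : ℝ) : ℂ) ^ (l₂ + (ℓ : ℂ) - 1)
  have hsub := intervalIntegral.integral_comp_mul_sub F (two_ne_zero (α := ℝ)) 1 (a := 0) (b := 1)
  rw [show (2 : ℝ) * 0 - 1 = -1 by norm_num, show (2 : ℝ) * 1 - 1 = 1 by norm_num] at hsub
  have hF : ∫ t in (0 : ℝ)..1, F (2 * t - 1) =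
      (2 : ℂ) ^ (l₁ + ℓ - 1) * (2 : ℂ) ^ (l₂ + ℓ - 1) *
        avg g (betaWeight (l₁ + ℓ) (l₂ + ℓ)) p := by
    rw [avg, ← intervalIntegral.integral_const_mul]
    refine intervalIntegral.integral_congr fun t ht => ?_
    rw [Set.uIcc_of_le zero_le_one] at ht
    have e1 : ((1 - (2 * t - 1) : ℝ) : ℂ) ^ (l₁ + (ℓ : ℂ) - 1) =
        (2 : ℂ) ^ (l₁ + ℓ - 1) * (1 - (t : ℂ)) ^ (l₁ + ℓ - 1) := by
      have := Complex.mul_cpow_ofReal_nonneg zero_le_two (sub_nonneg.2 ht.2) (l₁ + ℓ - 1)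
      push_cast at this ⊢
      rw [← this]
      congr 1
      ring
    have e2 : ((1 + (2 * t - 1) : ℝ) : ℂ) ^ (l₂ + (ℓ : ℂ) - 1) =
        (2 : ℂ) ^ (l₂ + ℓ - 1) * (t : ℂ) ^ (l₂ + ℓ - 1) := by
      have := Complex.mul_cpow_ofReal_nonneg zero_le_two ht.1 (l₂ + ℓ - 1)
      push_cast at this ⊢
      rw [← this]
      congr 1
      ring
    have e3 : (((p.2 : ℂ) - p.1) * ((2 * t - 1 : ℝ) : ℂ) + ((p.1 : ℂ) + p.2)) / 2 =
        seg (p.1, p.2) t := by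
      simp only [seg]; push_cast; ring
    simp only [F, betaWeight]
    rw [e1, e2, e3]
    ring
  rw [hF] at hsub
  have hsub' : ∫ v in (-1 : ℝ)..1, F v = 2 * ((2 : ℂ) ^ (l₁ + ℓ - 1) * (2 : ℂ) ^ (l₂ + ℓ - 1) *
        avg g (betaWeight (l₁ + ℓ) (l₂ + ℓ)) p) := by
    rw [hsub, Complex.real_smul]; push_cast; ring
  have h2 : (2 : ℂ) ^ (l₁ + l₂ + 2 * (ℓ : ℂ) - 1) =
      2 * ((2 : ℂ) ^ (l₁ + ℓ - 1) * (2 : ℂ) ^ (l₂ + ℓ - 1)) := by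
    rw [← Complex.cpow_add _ _ two_ne_zero]
    have := Complex.cpow_add 1 (l₁ + ℓ - 1 + (l₂ + ℓ - 1)) (two_ne_zero (α := ℂ))
    rw [Complex.cpow_one] at this
    rw [← this]
    congr 1
    ring
  have h0 : (2 : ℂ) ^ (l₁ + l₂ + 2 * (ℓ : ℂ) - 1) ≠ 0 := by
    rw [Complex.cpow_def_of_ne_zero two_ne_zero]; exact Complex.exp_ne_zero _
  have hf : (ℓ.factorial : ℂ) ≠ 0 := by exact_mod_cast ℓ.factorial_ne_zero
  rw [Psi]
  change _ * ∫ v in (-1 : ℝ)..1, F v = _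
  rw [hsub', ← mul_assoc 2, ← h2]
  field_simp

/-! ### The constant `c_ℓ`, the composition `RC ∘ Psi` and the inverse. -/

section Holographic

variable {l₁ l₂ : ℂ}

/-- Put `s = l₁ + l₂ + ℓ - 1`. Then `(s)_ℓ = Γ(s+ℓ)/Γ(s)`, the beta integral has denominator
`Γ(s+ℓ+1) = (s+ℓ) Γ(s+ℓ)`, and `Γ(s+ℓ)` cancels. For `ℓ = 0` the number `s` may be a pole of `Γ`. -/
theorem cConst_eq (h₁ : 0 < l₁.re) (h₂ : 0 < l₂.re) (ℓ : ℕ) :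
    cConst l₁ l₂ ℓ = poch (l₁ + l₂ + ℓ - 1) ℓ / ℓ.factorial *
      Complex.betaIntegral (l₂ + ℓ) (l₁ + ℓ) := by
  have hℓ : (0 : ℝ) ≤ ℓ := ℓ.cast_nonneg
  have ha : 0 < (l₁ + ℓ).re := by simp; linarith
  have hb : 0 < (l₂ + ℓ).re := by simp; linarith
  have hB := Complex.Gamma_mul_Gamma_eq_betaIntegral hb ha
  have hf : (ℓ.factorial : ℂ) ≠ 0 := by exact_mod_cast ℓ.factorial_ne_zero
  have hG : Complex.Gamma (l₂ + ℓ + (l₁ + ℓ)) ≠ 0 :=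
    Complex.Gamma_ne_zero_of_re_pos (by rw [Complex.add_re]; linarith)
  rcases ℓ with _ | n
  · simp only [Nat.cast_zero, add_zero] at hB hG
    simp only [cConst, poch, if_true, ascPochhammer_zero, Polynomial.eval_one, Nat.factorial_zero,
      Nat.cast_one, div_one, one_mul, Nat.cast_zero, add_zero]
    rw [mul_comm, hB, add_comm l₁, mul_div_cancel_left₀ _ hG]
  · have hs : 0 < (l₁ + l₂ + ((n + 1 : ℕ) : ℂ) - 1).re := by
      simp only [Complex.sub_re, Complex.add_re, Complex.natCast_re, Complex.one_re]
      push_cast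
      have : (0 : ℝ) ≤ n := n.cast_nonneg
      linarith
    rw [cConst, if_neg (Nat.succ_ne_zero n), poch]
    set s := l₁ + l₂ + ((n + 1 : ℕ) : ℂ) - 1 with hsdef
    have hp := Complex.Gamma_add_nat_div_Gamma_eq (n := n + 1) s (fun k hk => by
      rw [hk, Complex.neg_re, Complex.natCast_re] at hs
      linarith [k.cast_nonneg (α := ℝ)])
    have hGs : Complex.Gamma s ≠ 0 := Complex.Gamma_ne_zero_of_re_pos hs
    have hs1 : s + ((n + 1 : ℕ) : ℂ) ≠ 0 := by
      intro h
      have := congrArg Complex.re h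
      rw [Complex.add_re, Complex.natCast_re, Complex.zero_re] at this
      linarith
    have hrec := Complex.Gamma_add_one _ hs1
    have e1 : l₂ + ((n + 1 : ℕ) : ℂ) + (l₁ + ((n + 1 : ℕ) : ℂ)) = s + ((n + 1 : ℕ) : ℂ) + 1 := by
      rw [hsdef]; ring
    have e2 : l₁ + l₂ + 2 * ((n + 1 : ℕ) : ℂ) - 1 = s + ((n + 1 : ℕ) : ℂ) := by rw [hsdef]; ring
    rw [e1, hrec] at hB
    rw [← hp, e2, mul_comm (Complex.Gamma (l₁ + _)), hB]
    field_simp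

theorem cConst_ne_zero (h₁ : 0 < l₁.re) (h₂ : 0 < l₂.re) (ℓ : ℕ) : cConst l₁ l₂ ℓ ≠ 0 := by
  have hℓ : (0 : ℝ) ≤ ℓ := ℓ.cast_nonneg
  have ha : Complex.Gamma (l₁ + ℓ) ≠ 0 :=
    Complex.Gamma_ne_zero_of_re_pos (by simp; linarith)
  have hb : Complex.Gamma (l₂ + ℓ) ≠ 0 :=
    Complex.Gamma_ne_zero_of_re_pos (by simp; linarith)
  rcases ℓ with _ | n
  · simp only [Nat.cast_zero, add_zero] at ha hb
    rw [cConst, if_pos rfl]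
    exact div_ne_zero (mul_ne_zero ha hb)
      (Complex.Gamma_ne_zero_of_re_pos (by rw [Complex.add_re]; linarith))
  · have hn : (0 : ℝ) ≤ n := n.cast_nonneg
    rw [cConst, if_neg (Nat.succ_ne_zero n)]
    refine div_ne_zero (mul_ne_zero ha hb) (mul_ne_zero (mul_ne_zero ?_ ?_) ?_)
    · intro h
      have := congrArg Complex.re h
      simp at this
      linarith
    · refine Complex.Gamma_ne_zero_of_re_pos ?_
      simp
      linarith
    · exact_mod_cast (n + 1).factorial_ne_zero

theorem Psi_mem_Sol (h₁ : 0 < l₁.re) (h₂ : 0 < l₂.re) (ℓ : ℕ) {g : ℍ → ℂ}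
    (hg : g ∈ HolUHP) : Psi l₁ l₂ ℓ g ∈ Sol l₁ l₂ (eigenval l₁ l₂ ℓ) := by
  have hℓ : (0 : ℝ) ≤ ℓ := ℓ.cast_nonneg
  have ha : 0 < (l₁ + ℓ).re := by simp; linarith
  have hb : 0 < (l₂ + ℓ).re := by simp; linarith
  have hA := (hasPartials_avg hg (intervalIntegrable_betaWeight ha hb)).mem
  have hc := (hasPartials hA).const_mul (ℓ.factorial : ℂ)⁻¹
  have hc2 := (hasPartials (partial2_mem hA)).const_mul (ℓ.factorial : ℂ)⁻¹
  rw [Psi_eq]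
  refine sub_pow_mul_mem_Sol hc.mem fun p => ?_
  have := opP_avg ha hb hg p
  simp only [opP] at this ⊢
  rw [hc.partial2_eq, hc.partial1_eq, hc2.partial1_eq]
  linear_combination (ℓ.factorial : ℂ)⁻¹ * this

/-- `Psi g` vanishes to order `ℓ` on the diagonal. There the segment shrinks to a point, so the
leading coefficient is a beta integral times `g`. -/
theorem RC_Psi (h₁ : 0 < l₁.re) (h₂ : 0 < l₂.re) (ℓ : ℕ) {g : ℍ → ℂ}
    (hg : g ∈ HolUHP) : RC l₁ l₂ ℓ (Psi l₁ l₂ ℓ g) = cConst l₁ l₂ ℓ • g := by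
  have hℓ : (0 : ℝ) ≤ ℓ := ℓ.cast_nonneg
  have ha : 0 < (l₁ + ℓ).re := by simp; linarith
  have hb : 0 < (l₂ + ℓ).re := by simp; linarith
  have hA := (hasPartials_avg hg (intervalIntegrable_betaWeight ha hb)).mem
  have hc := (hasPartials hA).const_mul (ℓ.factorial : ℂ)⁻¹
  have hf : (ℓ.factorial : ℂ) ≠ 0 := by exact_mod_cast ℓ.factorial_ne_zero
  have hPsi := (Psi_mem_Sol h₁ h₂ ℓ hg).1
  have hd (k : ℕ) (hk : k ≤ ℓ) (z : ℍ) := partial1_iterate_sub_pow_mul_diag hc.mem ℓ k hk z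
  rw [← Psi_eq] at hd
  funext z
  rw [RC_eq_of_vanishing l₁ l₂ hPsi (fun j hj z => by rw [hd j hj.le, if_neg hj.ne]),
    hd ℓ le_rfl, if_pos rfl, avg_betaWeight_diag, cConst_eq h₁ h₂ ℓ, Pi.smul_apply, smul_eq_mul]
  field_simp

end Holographic

theorem smul_mem_HolUHP (c : ℂ) {g : ℍ → ℂ} (hg : g ∈ HolUHP) : c • g ∈ HolUHP :=
  DifferentiableOn.const_mul hg c

theorem invOn_Psi {l₁ l₂ : ℂ} (h₁ : 0 < l₁.re) (h₂ : 0 < l₂.re) (ℓ : ℕ) :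
    Set.InvOn (fun f => (cConst l₁ l₂ ℓ)⁻¹ • RC l₁ l₂ ℓ f) (Psi l₁ l₂ ℓ) HolUHP
      (Sol l₁ l₂ (eigenval l₁ l₂ ℓ)) := by
  have hc := cConst_ne_zero h₁ h₂ ℓ
  refine ⟨fun g hg => ?_, fun f hf => ?_⟩
  · simp only [RC_Psi h₁ h₂ ℓ hg, inv_smul_smul₀ hc]
  · have hg := smul_mem_HolUHP (cConst l₁ l₂ ℓ)⁻¹ (RC_mem l₁ l₂ ℓ hf.1)
    have hP := Psi_mem_Sol h₁ h₂ ℓ hg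
    -- `f` minus its candidate `Psi (c⁻¹ RC f)` is a solution killed by `RC`; this is surjectivity.
    refine (sub_eq_zero.1 (eq_zero_of_RC_eq_zero (ℓ := ℓ) ?_ (sub_mem_Sol hf hP) ?_)).symm
    · rw [Complex.add_re]; linarith
    · rw [RC_sub l₁ l₂ ℓ hf.1 hP.1, RC_Psi h₁ h₂ ℓ hg, smul_inv_smul₀ hc, sub_self]

theorem bijOn_Psi {l₁ l₂ : ℂ} (h₁ : 0 < l₁.re) (h₂ : 0 < l₂.re) (ℓ : ℕ) :
    Set.BijOn (Psi l₁ l₂ ℓ) HolUHP (Sol l₁ l₂ (eigenval l₁ l₂ ℓ)) :=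
  (invOn_Psi h₁ h₂ ℓ).bijOn (fun _ hg => Psi_mem_Sol h₁ h₂ ℓ hg)
    fun _ hf => smul_mem_HolUHP _ (RC_mem l₁ l₂ ℓ hf.1)

end Integral

end RankinCohen

end

theorem mainTheorem9 (l₁ l₂ : ℂ) :
    -- the operator `P` is the diagonal Casimir, up to an affine change
    (∀ f ∈ RankinCohen.HolUHP2, ∀ p,
      RankinCohen.diagCasimir l₁ l₂ f p =
        -(1 / 2) * RankinCohen.opP l₁ l₂ f p + (1 / 8) * (l₁ + l₂) * (l₁ + l₂ - 2) * f p) ∧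
    -- (1)
    (∀ μ : ℂ, RankinCohen.Sol l₁ l₂ μ ≠ {0} ↔ ∃ ℓ : ℕ, μ = RankinCohen.eigenval l₁ l₂ ℓ) ∧
    -- (2)
    (∀ ℓ : ℕ, RankinCohen.minKType l₁ l₂ ℓ ∈
      RankinCohen.Sol l₁ l₂ (RankinCohen.eigenval l₁ l₂ ℓ)) ∧
    -- (3)
    (0 < l₁.re → 0 < l₂.re → ∀ ℓ : ℕ,
      Set.BijOn (RankinCohen.Psi l₁ l₂ ℓ) RankinCohen.HolUHP
        (RankinCohen.Sol l₁ l₂ (RankinCohen.eigenval l₁ l₂ ℓ)) ∧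
      (∀ g ∈ RankinCohen.HolUHP,
        RankinCohen.RC l₁ l₂ ℓ (RankinCohen.Psi l₁ l₂ ℓ g) = RankinCohen.cConst l₁ l₂ ℓ • g) ∧
      RankinCohen.cConst l₁ l₂ ℓ ≠ 0 ∧
      Set.InvOn (fun f => (RankinCohen.cConst l₁ l₂ ℓ)⁻¹ • RankinCohen.RC l₁ l₂ ℓ f)
        (RankinCohen.Psi l₁ l₂ ℓ) RankinCohen.HolUHP
        (RankinCohen.Sol l₁ l₂ (RankinCohen.eigenval l₁ l₂ ℓ))) := by
  open RankinCohen in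
  exact ⟨fun f hf p => diagCasimir_eq l₁ l₂ hf p, Sol_ne_zero_iff l₁ l₂, minKType_mem_Sol l₁ l₂,
    fun h₁ h₂ ℓ => ⟨bijOn_Psi h₁ h₂ ℓ, fun g hg => RC_Psi h₁ h₂ ℓ hg, cConst_ne_zero h₁ h₂ ℓ,
      invOn_Psi h₁ h₂ ℓ⟩⟩
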